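/- Fix $g\ge 1$ and noncommuting symmetric variables $(a,x)=(a_1,\dots,a_g,x_1,\dots,x_g)$. Polynomials are elements of the free algebra $\mathbb R\langle a,x\rangle$, with the involution ${}^T$ that reverses words and fixes the variables; $p$ is symmetric if $p^T=p$. Let $\mathbb S_n$ be the real symmetric $n\times n$ matrices and $\mathbb S_n(\mathbb R^k)$ the $k$-tuples of them; polynomials are evaluated at such tuples. A domain in $\mathbb S(\mathbb R^k)=(\mathbb S_n(\mathbb R^k))_n$ is a sequence $\mathcal D=(\mathcal D_n)_n$ of sets $\mathcal D_n\subset\mathbb S_n(\mathbb R^k)$ closed under direct sums (if $Y\in\mathcal D_n$ and $Z\in\mathcal D_m$, then $Y\oplus Z\in\mathcal D_{n+m}$). It is matrix convex if $V^TYV\in\mathcal D_m$ for all $Y\in\mathcal D_n$ and all isometries $V:\mathbb R^m\to\mathbb R^n$. A domain $\mathcal W$ in $\mathbb S(\mathbb R^g\times\mathbb R^g)$ is open in $a$ if for all $(A,X)\in\mathcal W_n$ there is an open set $U\subset\mathbb S_n(\mathbb R^g)$ containing $A$ with $U\times\{X\}\subset\mathcal W_n$; and $\pi_a(\mathcal W_n)=\{A:(A,X)\in\mathcal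 W_n\text{ for some }X\}$. The partial Hessian $\frac{\partial^2}{\partial x^2}p(a,x)[h]$ is the second derivative at $t=0$ of $p(a,x+th)$, a polynomial in $(a,x,h)$. Theorem. Let $p(a,x)$ be a symmetric polynomial of degree $d_a$ in $a$ and degree $d_x\ge 2$ in $x$. Let $\mathcal W$ be a domain in $\mathbb S(\mathbb R^g\times\mathbb R^g)$ that is open in $a$, and suppose that $\frac{\partial^2}{\partial x^2}p(A,X)[H]\succeq 0$ for every $n$, every $(A,X)\in\mathcal W_n$ and every $H\in\mathbb S_n(\mathbb R^g)$. Then either (A) there is a nonzero polynomial $q$ (not necessarily symmetric), of degree at most $d_a$ in $a$ and at most $d_x-2$ in $x$, such that $q(A,X)=0$ for all $n$ and all $(A,X)\in\mathcal W_n$; or (B) $p$ has degree at most two in $x$, and for each $n$ and each $A\in\pi_a(\mathcal W_n)$ the function $X\mapsto p(A,X)$ is convex on all of $\mathbb S_n(\mathbb R^g)$, i.e. $p(A,tX+(1-t)Y)\preceq t\,p(A,X)+(1-t)\,p(A,Y)$ for all $X,Y\in\mathbb S_n(\mathbb R^g)$ and $0<t<1$. In particular, if $\mathcal W=\mathbb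 S(\mathbb R^g)\times\mathcal V$, where $\mathcal V$ is a matrix convex domain in $\mathbb S(\mathbb R^g)$, and the partial Hessian of $p$ is positive semidefinite on $\mathcal W$ as above, then either (A$'$) there is a nonzero polynomial $q$, of degree at most $d_a$ in $a$ and at most $d_x-2$ in $x$, such that $q(A,X)=0$ for all $n$ and all $(A,X)\in\mathcal W_n$; or (B$'$) there are a polynomial $L(a,x)$ of degree at most one in $x$ and a finite column vector $\Lambda(a,x)$ of polynomials which are linear (homogeneous of degree one) in $x$ such that $$p=L+\Lambda^T\Lambda=L+\sum_j\Lambda_j^T\Lambda_j .$$ -/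

import Mathlib

open scoped Topology

noncomputable section

namespace NCConvex

/-- Noncommutative polynomials over `ℝ` in symmetric letters from `σ`. The involution which reverses
words and fixes the letters is Mathlib's `star` on `FreeAlgebra`. -/
abbrev NCPoly (σ : Type) := FreeAlgebra ℝ σ

/-- The (finite) set of words occurring in `p` with nonzero coefficient. -/
def words {σ : Type} (p : NCPoly σ) : Finset (FreeMonoid σ) :=
  (FreeAlgebra.equivMonoidAlgebraFreeMonoid p).coeff.support

/-- The letters `(a, x) = (a₁, …, a_g, x₁, …, x_g)`: `Sum.inl j` is `a_j`, `Sum.inr j` is `x_j`. -/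
abbrev AX (g : ℕ) := Fin g ⊕ Fin g

/-- The number of `a`-letters of a word. -/
def aCount {g : ℕ} (w : FreeMonoid (AX g)) : ℕ := (FreeMonoid.toList w).countP (fun l => l.isLeft)

/-- The number of `x`-letters of a word. -/
def xCount {g : ℕ} (w : FreeMonoid (AX g)) : ℕ := (FreeMonoid.toList w).countP (fun l => l.isRight)

/-- The degree of `p` in `a` (with the convention that the zero polynomial has degree `0`). -/
def degA {g : ℕ} (p : NCPoly (AX g)) : ℕ := (words p).sup aCount

/-- The degree of `p` in `x` (with the convention that the zero polynomial has degree `0`). -/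
def degX {g : ℕ} (p : NCPoly (AX g)) : ℕ := (words p).sup xCount

/-- `p` is linear in `x`, i.e. every word of `p` contains exactly one `x`-letter. -/
def LinearInX {g : ℕ} (p : NCPoly (AX g)) : Prop := ∀ w ∈ words p, xCount w = 1

/-- The space `𝕊ₙ` of real symmetric `n × n` matrices. -/
def SymMat (n : ℕ) : Submodule ℝ (Matrix (Fin n) (Fin n) ℝ) where
  carrier := {M | M.IsSymm}
  add_mem' := fun hA hB => hA.add hB
  zero_mem' := Matrix.isSymm_zero
  smul_mem' := fun c _ hA => hA.smul c

/-- Tuples of symmetric `n × n` matrices, indexed by the letters `ι`. -/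
abbrev SymTuple (ι : Type) (n : ℕ) := ι → SymMat n

/-- The value `p(Y)` of a polynomial at a tuple of symmetric matrices. -/
def eval {σ : Type} {n : ℕ} (Y : SymTuple σ n) (p : NCPoly σ) : Matrix (Fin n) (Fin n) ℝ :=
  FreeAlgebra.lift ℝ (fun i => (Y i : Matrix (Fin n) (Fin n) ℝ)) p

/-- The tuple `(A, X)`. -/
abbrev pair {g n : ℕ} (A X : SymTuple (Fin g) n) : SymTuple (AX g) n := Sum.elim A X

/-- The letters `(a, x, h)`. -/
abbrev AXH (g : ℕ) := Fin g ⊕ Fin g ⊕ Fin g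

/-- The polynomial `t ↦ p(a, x + t h)` in the central variable `t`, with coefficients in the
noncommutative polynomials in `(a, x, h)`. -/
def lineX {g : ℕ} (p : NCPoly (AX g)) : Polynomial (NCPoly (AXH g)) :=
  FreeAlgebra.lift ℝ
    (Sum.elim
      (fun j => Polynomial.C (FreeAlgebra.ι ℝ (Sum.inl j)))
      (fun j => Polynomial.C (FreeAlgebra.ι ℝ (Sum.inr (Sum.inl j)))
        + Polynomial.X * Polynomial.C (FreeAlgebra.ι ℝ (Sum.inr (Sum.inr j))))) p

/-- The partial Hessian `∂²p/∂x² (a, x)[h]`: the second derivative of `p(a, x + t h)` in `t`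
at `t = 0`. -/
def partialHessian {g : ℕ} (p : NCPoly (AX g)) : NCPoly (AXH g) :=
  (Polynomial.derivative (Polynomial.derivative (lineX p))).eval 0

/-- The value `∂²p/∂x² (A, X)[H]`. -/
def hessianAt {g n : ℕ} (p : NCPoly (AX g)) (A X H : SymTuple (Fin g) n) :
    Matrix (Fin n) (Fin n) ℝ :=
  eval (Sum.elim A (Sum.elim X H)) (partialHessian p)

/-- The direct sum of symmetric matrices. -/
def dsum {n m : ℕ} (M : SymMat n) (N : SymMat m) : SymMat (n + m) :=
  ⟨Matrix.reindex finSumFinEquiv finSumFinEquiv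
      (Matrix.fromBlocks (M : Matrix (Fin n) (Fin n) ℝ) 0 0 (N : Matrix (Fin m) (Fin m) ℝ)), by
    have hM : (M : Matrix (Fin n) (Fin n) ℝ).IsSymm := M.2
    have hN : (N : Matrix (Fin m) (Fin m) ℝ).IsSymm := N.2
    exact (Matrix.IsSymm.fromBlocks hM (by simp) hN).submatrix _⟩

/-- A noncommutative domain: a sequence of sets of tuples of symmetric matrices which is closed
under direct sums. -/
structure NCDomain (ι : Type) where
  /-- The part of the domain at matrix size `n`. -/
  level : (n : ℕ) → Set (SymTuple ι n)
  dsum_mem : ∀ {n m : ℕ} {Y : SymTuple ι n} {Z : SymTuple ι m},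
    Y ∈ level n → Z ∈ level m → (fun i => dsum (Y i) (Z i)) ∈ level (n + m)

/-- The whole domain `𝕊(ℝ^ι)`. -/
def NCDomain.whole (ι : Type) : NCDomain ι where
  level := fun _ => Set.univ
  dsum_mem := fun _ _ => Set.mem_univ _

/-- The product domain `𝒰 × 𝒱`. -/
def NCDomain.prod {g : ℕ} (U V : NCDomain (Fin g)) : NCDomain (AX g) where
  level := fun n => {Y | (fun j => Y (Sum.inl j)) ∈ U.level n ∧ (fun j => Y (Sum.inr j)) ∈ V.level n}
  dsum_mem := fun hY hZ => ⟨U.dsum_mem hY.1 hZ.1, V.dsum_mem hY.2 hZ.2⟩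

/-- The coordinate projection `π_a(𝒲_n)`. -/
def NCDomain.projA {g : ℕ} (W : NCDomain (AX g)) (n : ℕ) : Set (SymTuple (Fin g) n) :=
  {A | ∃ X, pair A X ∈ W.level n}

/-- `𝒲` is open in `a`. -/
def NCDomain.OpenInA {g : ℕ} (W : NCDomain (AX g)) : Prop :=
  ∀ (n : ℕ) (A X : SymTuple (Fin g) n), pair A X ∈ W.level n →
    ∃ U : Set (SymTuple (Fin g) n), IsOpen U ∧ A ∈ U ∧ ∀ B ∈ U, pair B X ∈ W.level n

/-- The compression `Vᵀ M V`. -/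
def compress {n m : ℕ} (V : Matrix (Fin n) (Fin m) ℝ) (M : SymMat n) : SymMat m :=
  ⟨V.transpose * (M : Matrix (Fin n) (Fin n) ℝ) * V, by
    have hM : (M : Matrix (Fin n) (Fin n) ℝ).transpose = M := M.2
    change (V.transpose * (M : Matrix (Fin n) (Fin n) ℝ) * V).transpose = _
    simp [Matrix.transpose_mul, hM, Matrix.mul_assoc]⟩

/-- A domain is matrix convex if it is closed under compression by isometries `ℝᵐ → ℝⁿ`. -/
def NCDomain.MatrixConvex {ι : Type} (D : NCDomain ι) : Prop :=
  ∀ (n m : ℕ) (V : Matrix (Fin n) (Fin m) ℝ), V.transpose * V = 1 →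
    ∀ Y ∈ D.level n, (fun i => compress V (Y i)) ∈ D.level m

/-- The partial `x`-Hessian of `p` is positive semidefinite on `𝒲`. -/
def HessianPosSemidefOn {g : ℕ} (p : NCPoly (AX g)) (W : NCDomain (AX g)) : Prop :=
  ∀ (n : ℕ) (A X : SymTuple (Fin g) n), pair A X ∈ W.level n →
    ∀ H : SymTuple (Fin g) n, (hessianAt p A X H).PosSemidef

/-- For the fixed tuple `A`, the function `X ↦ p(A, X)` is globally convex. -/
def GloballyConvexAt {g n : ℕ} (p : NCPoly (AX g)) (A : SymTuple (Fin g) n) : Prop :=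
  ∀ (X Y : SymTuple (Fin g) n) (t : ℝ), 0 < t → t < 1 →
    (t • eval (pair A X) p + (1 - t) • eval (pair A Y) p
      - eval (pair A (t • X + (1 - t) • Y)) p).PosSemidef

/-- `q` vanishes on `𝒲`. -/
def VanishesOn {g : ℕ} (q : NCPoly (AX g)) (W : NCDomain (AX g)) : Prop :=
  ∀ (n : ℕ), ∀ Y ∈ W.level n, eval Y q = 0

end NCConvex

end

/-! Every term of the Hessian comes from a word `u x_i v x_j w` of `p`. Hence `z ⬝ p_xx(A,X)[H] z`
is twice the middle form `formₗ`, evaluated at the border vectors `ξ_{j,w} = H_j w(A,X) z`. The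
border words have degree at most `d_a` in `a` and `d_x - 2` in `x`.

Suppose no nonzero polynomial within these bounds vanishes on the domain. Closure under direct sums
then gives one point `Z` and one vector `v₀` such that `q ↦ q(Z) v₀` is injective on all of them
(`exists_separating`). At `Y ⊕ Z`, off-diagonal directions `H_j` can carry the independent vectors
`w(Z) v₀` to arbitrary targets, so the middle form at every `Y` of the domain is nonnegative on all
families `ξ`, not only on those of the special shape above (`formₗ_nonneg`).

A nonnegative form with a zero diagonal entry has zero symmetrized cross terms with that entry. If
`d_x > 2`, a word of top degree in `x` produces such a zero entry and a nonzero cross term, a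
contradiction (`degX_le_two`). So `d_x ≤ 2`; the middle words then contain no `x`, the form depends
on `A` alone, and its positivity is convexity of `p(A, ·)`.

When `A` is unrestricted, positivity yields a sum of squares. If the quadratic part lay outside the
cone of squares of linear words, a functional negative on it and strictly positive on nonzero
squares would exist (`exists_separating_functional`). A truncated GNS construction
(`exists_representation`) turns this functional into a tuple `A` and border vectors on which the
middle form is negative. -/

noncomputable section

namespace NCConvex

/-! ### Coefficients and linear extension from monomials -/

section Words

variable {σ : Type}

/-- The coefficients of a noncommutative polynomial, indexed by lists of letters. -/
def coeffs : NCPoly σ ≃ₗ[ℝ] (List σ →₀ ℝ) :=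
  (FreeAlgebra.equivMonoidAlgebraFreeMonoid.toLinearEquiv.trans
    (MonoidAlgebra.coeffLinearEquiv ℝ)).trans (Finsupp.domLCongr FreeMonoid.toList)

/-- The monomial with the given letters. -/
def mono (l : List σ) : NCPoly σ := (l.map (FreeAlgebra.ι ℝ)).prod

@[simp] lemma mono_nil : mono ([] : List σ) = 1 := rfl

@[simp] lemma mono_cons (c : σ) (l : List σ) : mono (c :: l) = FreeAlgebra.ι ℝ c * mono l := by
  simp [mono]

@[simp] lemma mono_append (l m : List σ) : mono (l ++ m) = mono l * mono m := by
  simp [mono]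

@[simp] lemma star_mono (l : List σ) : star (mono l) = mono l.reverse := by
  induction l with
  | nil => simp
  | cons c l ih => simp [ih]

lemma mem_words_iff (p : NCPoly σ) (w : FreeMonoid σ) :
    w ∈ words p ↔ coeffs p w.toList ≠ 0 := by
  simp [words, coeffs, MonoidAlgebra.coeffLinearEquiv]

@[simp] lemma coeffs_mono (l : List σ) : coeffs (mono l) = Finsupp.single l 1 := by
  have h : FreeAlgebra.equivMonoidAlgebraFreeMonoid (mono l)
      = MonoidAlgebra.single (FreeMonoid.ofList l) (1 : ℝ) := by
    induction l with
    | nil => rw [mono_nil, map_one]; rfl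
    | cons c l ih =>
      rw [mono_cons, map_mul, ih]
      simp [FreeAlgebra.equivMonoidAlgebraFreeMonoid, MonoidAlgebra.of_apply,
        MonoidAlgebra.single_mul_single]
  simp [coeffs, h, MonoidAlgebra.coeffLinearEquiv]

/-- The linear extension to polynomials of a function of the monomials. -/
def wordSum {M : Type*} [AddCommGroup M] [Module ℝ M] (F : List σ → M) : NCPoly σ →ₗ[ℝ] M :=
  Finsupp.linearCombination ℝ F ∘ₗ coeffs.toLinearMap

lemma wordSum_apply {M : Type*} [AddCommGroup M] [Module ℝ M] (F : List σ → M) (p : NCPoly σ) :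
    wordSum F p = ∑ l ∈ (coeffs p).support, coeffs p l • F l := rfl

@[simp] lemma wordSum_mono {M : Type*} [AddCommGroup M] [Module ℝ M] (F : List σ → M)
    (l : List σ) : wordSum F (mono l) = F l := by
  simp [wordSum]

/-- The monomials form a basis; this reduces later identities that are linear in the polynomial to a
single word. -/
lemma linearMap_ext_mono {M : Type*} [AddCommGroup M] [Module ℝ M] {f f' : NCPoly σ →ₗ[ℝ] M}
    (h : ∀ l, f (mono l) = f' (mono l)) : f = f' := by
  have : f ∘ₗ coeffs.symm.toLinearMap = f' ∘ₗ coeffs.symm.toLinearMap := by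
    refine Finsupp.lhom_ext' fun l => LinearMap.ext_ring ?_
    have hl : coeffs.symm (Finsupp.single l 1) = mono l := by
      rw [LinearEquiv.symm_apply_eq, coeffs_mono]
    simpa [hl] using h l
  ext p
  simpa using LinearMap.congr_fun this (coeffs p)

lemma wordSum_mono_eq (p : NCPoly σ) : wordSum mono p = p := by
  have : wordSum (mono (σ := σ)) = LinearMap.id := linearMap_ext_mono fun l => by simp
  simp [this]

lemma linearMap_eq_wordSum {M : Type*} [AddCommGroup M] [Module ℝ M] (f : NCPoly σ →ₗ[ℝ] M)
    (p : NCPoly σ) : f p = wordSum (fun l => f (mono l)) p := by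
  have : f = wordSum (fun l => f (mono l)) := linearMap_ext_mono fun l => by simp
  exact LinearMap.congr_fun this p

lemma wordSum_congr {M : Type*} [AddCommGroup M] [Module ℝ M] {F F' : List σ → M} {p : NCPoly σ}
    (h : ∀ l, coeffs p l ≠ 0 → F l = F' l) : wordSum F p = wordSum F' p := by
  rw [wordSum_apply, wordSum_apply]
  exact Finset.sum_congr rfl fun l hl => by rw [h l (by simpa using hl)]

lemma coeffs_star (p : NCPoly σ) (l : List σ) : coeffs (star p) l = coeffs p l.reverse := by
  let st : NCPoly σ →ₗ[ℝ] NCPoly σ :=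
    { toFun := star
      map_add' := star_add
      map_smul' := fun c q => by
        simp [Algebra.smul_def, star_mul, FreeAlgebra.star_algebraMap, Algebra.commutes] }
  have h : (Finsupp.lapply l ∘ₗ coeffs.toLinearMap) ∘ₗ st
      = Finsupp.lapply l.reverse ∘ₗ coeffs.toLinearMap := by
    refine linearMap_ext_mono fun m => ?_
    change coeffs (star (mono m)) l = coeffs (mono m) l.reverse
    classical
    rw [star_mono, coeffs_mono, coeffs_mono, Finsupp.single_apply, Finsupp.single_apply]
    simp [List.reverse_eq_iff]
  exact LinearMap.congr_fun h p

lemma star_smul_real (c : ℝ) (q : NCPoly σ) : star (c • q) = c • star q := by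
  simp [Algebra.smul_def, star_mul, FreeAlgebra.star_algebraMap, Algebra.commutes]

end Words

/-! ### Evaluation, transposes and direct sums -/

section Evaluation

variable {σ : Type}

/-- Evaluation at a tuple of matrices as a linear map. -/
def evalₗ {n : ℕ} (Y : SymTuple σ n) : NCPoly σ →ₗ[ℝ] Matrix (Fin n) (Fin n) ℝ :=
  (FreeAlgebra.lift ℝ (fun i => (Y i : Matrix (Fin n) (Fin n) ℝ))).toLinearMap

@[simp] lemma evalₗ_apply {n : ℕ} (Y : SymTuple σ n) (p : NCPoly σ) : evalₗ Y p = eval Y p := rfl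

@[simp] lemma eval_ι {n : ℕ} (Y : SymTuple σ n) (i : σ) : eval Y (FreeAlgebra.ι ℝ i) = Y i := by
  simp [eval]

lemma eval_mul {n : ℕ} (Y : SymTuple σ n) (p q : NCPoly σ) :
    eval Y (p * q) = eval Y p * eval Y q := by simp [eval]

lemma eval_add {n : ℕ} (Y : SymTuple σ n) (p q : NCPoly σ) :
    eval Y (p + q) = eval Y p + eval Y q := by simp [eval]

@[simp] lemma eval_zero {n : ℕ} (Y : SymTuple σ n) : eval Y (0 : NCPoly σ) = 0 := by simp [eval]

@[simp] lemma eval_one {n : ℕ} (Y : SymTuple σ n) : eval Y (1 : NCPoly σ) = 1 := by simp [eval]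

lemma eval_star {n : ℕ} (Y : SymTuple σ n) (p : NCPoly σ) :
    eval Y (star p) = (eval Y p).transpose := by
  induction p using FreeAlgebra.induction with
  | grade0 r => simp [eval, FreeAlgebra.star_algebraMap, Matrix.algebraMap_eq_diagonal]
  | grade1 i => simpa using (show (Y i : Matrix (Fin n) (Fin n) ℝ).IsSymm from (Y i).2).symm
  | mul a b ha hb => simp [eval_mul, ha, hb, Matrix.transpose_mul]
  | add a b ha hb => simp [eval_add, ha, hb]

lemma eval_isSymm {n : ℕ} (Y : SymTuple σ n) {p : NCPoly σ} (hp : star p = p) :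
    (eval Y p).IsSymm := by
  rw [Matrix.IsSymm, ← eval_star, hp]

lemma eval_dsum {n m : ℕ} (Y : SymTuple σ n) (Z : SymTuple σ m) (p : NCPoly σ) :
    eval (fun i => dsum (Y i) (Z i)) p
      = Matrix.reindex finSumFinEquiv finSumFinEquiv
          (Matrix.fromBlocks (eval Y p) 0 0 (eval Z p)) := by
  let e := Matrix.reindexAlgEquiv ℝ ℝ (finSumFinEquiv (m := n) (n := m))
  change _ = e (Matrix.fromBlocks (eval Y p) 0 0 (eval Z p))
  induction p using FreeAlgebra.induction with
  | grade0 r =>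
    have : Matrix.fromBlocks (eval Y (algebraMap ℝ _ r)) 0 0 (eval Z (algebraMap ℝ _ r))
        = algebraMap ℝ (Matrix (Fin n ⊕ Fin m) (Fin n ⊕ Fin m) ℝ) r := by
      simp [eval, Matrix.algebraMap_eq_diagonal, Matrix.fromBlocks_diagonal]
    rw [this, AlgEquiv.commutes]; simp [eval]
  | grade1 i => simp [e, dsum]
  | mul a b ha hb =>
    rw [eval_mul, ha, hb, ← map_mul, Matrix.fromBlocks_multiply]
    simp [eval_mul]
  | add a b ha hb =>
    rw [eval_add, ha, hb, ← map_add, Matrix.fromBlocks_add]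
    simp [eval_add]

/-- Concatenation of vectors. -/
def vsum {n m : ℕ} (v : Fin n → ℝ) (w : Fin m → ℝ) : Fin (n + m) → ℝ :=
  Sum.elim v w ∘ finSumFinEquiv.symm

lemma vsum_inj {n m : ℕ} {v v' : Fin n → ℝ} {w w' : Fin m → ℝ} :
    vsum v w = vsum v' w' ↔ v = v' ∧ w = w' := by
  rw [vsum, vsum, finSumFinEquiv.symm.surjective.injective_comp_right.eq_iff, Sum.elim_eq_iff]

lemma reindex_fromBlocks_mulVec {n m : ℕ} (A : Matrix (Fin n) (Fin n) ℝ)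
    (B : Matrix (Fin n) (Fin m) ℝ) (C : Matrix (Fin m) (Fin n) ℝ) (D : Matrix (Fin m) (Fin m) ℝ)
    (v : Fin n → ℝ) (w : Fin m → ℝ) :
    (Matrix.reindex finSumFinEquiv finSumFinEquiv (Matrix.fromBlocks A B C D)).mulVec (vsum v w)
      = vsum (A.mulVec v + B.mulVec w) (C.mulVec v + D.mulVec w) := by
  simp [vsum, Matrix.submatrix_mulVec_equiv, Matrix.fromBlocks_mulVec, Function.comp_assoc]

lemma vsum_dotProduct {n m : ℕ} (v v' : Fin n → ℝ) (w w' : Fin m → ℝ) :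
    vsum v w ⬝ᵥ vsum v' w' = v ⬝ᵥ v' + w ⬝ᵥ w' := by
  simp [vsum, dotProduct, Fin.sum_univ_add]

lemma eval_dsum_mulVec {n m : ℕ} (Y : SymTuple σ n) (Z : SymTuple σ m) (p : NCPoly σ)
    (v : Fin n → ℝ) (w : Fin m → ℝ) :
    (eval (fun i => dsum (Y i) (Z i)) p).mulVec (vsum v w)
      = vsum ((eval Y p).mulVec v) ((eval Z p).mulVec w) := by
  rw [eval_dsum, reindex_fromBlocks_mulVec]; simp

end Evaluation

/-! ### Splitting words at one or two `x`-letters -/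

section Splits

variable {g : ℕ}

/-- Prepending a letter to the first component. -/
def consSplit (c : AX g) : List (AX g) × Fin g × List (AX g) ↪ List (AX g) × Fin g × List (AX g) :=
  ⟨fun τ => (c :: τ.1, τ.2), fun τ τ' h => by
    simp only [Prod.mk.injEq, List.cons.injEq, true_and] at h
    exact Prod.ext h.1 h.2⟩

@[simp] lemma consSplit_apply (c : AX g) (τ : List (AX g) × Fin g × List (AX g)) :
    consSplit c τ = (c :: τ.1, τ.2) := rfl

/-- All ways of writing a word as `u x_j w`. -/
def splits : List (AX g) → Finset (List (AX g) × Fin g × List (AX g))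
  | [] => ∅
  | c :: l => (c.elim (fun _ => ∅) fun j => {([], j, l)}) ∪
      (splits l).map (consSplit c)

lemma mem_splits {l : List (AX g)} {τ : List (AX g) × Fin g × List (AX g)} :
    τ ∈ splits l ↔ τ.1 ++ Sum.inr τ.2.1 :: τ.2.2 = l := by
  obtain ⟨u, j, w⟩ := τ
  induction l generalizing u with
  | nil => simp [splits]
  | cons c l ih =>
    cases u with
    | nil =>
      rcases c with k | k
      · simp [splits]
      · simp only [splits, Sum.elim_inr, Finset.mem_union, Finset.mem_singleton, Finset.mem_map,
          consSplit_apply, Prod.mk.injEq, List.nil_append, List.cons.injEq, Sum.inr.injEq]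
        constructor
        · rintro (⟨-, h, h'⟩ | ⟨_, _, h, -⟩)
          · exact ⟨by rw [h], h'⟩
          · cases h
        · rintro ⟨h, h'⟩
          exact Or.inl ⟨trivial, by rw [h], h'⟩
    | cons d u =>
      rcases c with k | k <;> simp [splits, ih] <;> aesop

variable {M : Type*} [AddCommGroup M]

/-- The sum of `F u j w` over all ways of writing a word as `u x_j w`. -/
def sum₁ (F : List (AX g) → Fin g → List (AX g) → M) (l : List (AX g)) : M :=
  ∑ τ ∈ splits l, F τ.1 τ.2.1 τ.2.2

/-- The sum of `F u i v j w` over all ways of writing a word as `u x_i v x_j w`. -/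
def sum₂ (F : List (AX g) → Fin g → List (AX g) → Fin g → List (AX g) → M)
    (l : List (AX g)) : M :=
  sum₁ (fun u i r => sum₁ (F u i) r) l

@[simp] lemma sum₁_nil (F : List (AX g) → Fin g → List (AX g) → M) : sum₁ F [] = 0 := rfl

@[simp] lemma sum₁_cons_inl (F : List (AX g) → Fin g → List (AX g) → M) (k : Fin g)
    (l : List (AX g)) :
    sum₁ F (Sum.inl k :: l) = sum₁ (fun u => F (Sum.inl k :: u)) l := by
  simp [sum₁, splits]

@[simp] lemma sum₁_cons_inr (F : List (AX g) → Fin g → List (AX g) → M) (k : Fin g)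
    (l : List (AX g)) :
    sum₁ F (Sum.inr k :: l) = F [] k l + sum₁ (fun u => F (Sum.inr k :: u)) l := by
  rw [sum₁, splits, Finset.sum_union]
  · simp [sum₁]
  · simp

@[simp] lemma sum₂_nil (F : List (AX g) → Fin g → List (AX g) → Fin g → List (AX g) → M) :
    sum₂ F [] = 0 := rfl

@[simp] lemma sum₂_cons_inl
    (F : List (AX g) → Fin g → List (AX g) → Fin g → List (AX g) → M) (k : Fin g)
    (l : List (AX g)) :
    sum₂ F (Sum.inl k :: l) = sum₂ (fun u => F (Sum.inl k :: u)) l := by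
  simp [sum₂]

@[simp] lemma sum₂_cons_inr
    (F : List (AX g) → Fin g → List (AX g) → Fin g → List (AX g) → M) (k : Fin g)
    (l : List (AX g)) :
    sum₂ F (Sum.inr k :: l) = sum₁ (F [] k) l + sum₂ (fun u => F (Sum.inr k :: u)) l := by
  simp [sum₂]

lemma sum₂_congr {l : List (AX g)}
    {F F' : List (AX g) → Fin g → List (AX g) → Fin g → List (AX g) → M}
    (h : ∀ u i v j w, u ++ Sum.inr i :: (v ++ Sum.inr j :: w) = l → F u i v j w = F' u i v j w) :
    sum₂ F l = sum₂ F' l := by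
  refine Finset.sum_congr rfl fun τ hτ => Finset.sum_congr rfl fun ρ hρ => h _ _ _ _ _ ?_
  rw [mem_splits.1 hρ, mem_splits.1 hτ]

lemma map_sum₁ {N : Type*} [AddCommGroup N] (f : M →+ N)
    (F : List (AX g) → Fin g → List (AX g) → M) (l : List (AX g)) :
    f (sum₁ F l) = sum₁ (fun u j w => f (F u j w)) l := by
  simp [sum₁]

lemma map_sum₂ {N : Type*} [AddCommGroup N] (f : M →+ N)
    (F : List (AX g) → Fin g → List (AX g) → Fin g → List (AX g) → M) (l : List (AX g)) :
    f (sum₂ F l) = sum₂ (fun u i v j w => f (F u i v j w)) l := by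
  simp [sum₂, sum₁]

/-- A word has at most one splitting with prescribed pieces. This is what reads off the coefficients
of `middle`. -/
lemma sum₂_indicator (u₀ : List (AX g)) (i₀ : Fin g) (v₀ : List (AX g)) (j₀ : Fin g)
    (w₀ : List (AX g)) (F : List (AX g) → Fin g → List (AX g) → Fin g → List (AX g) → M)
    (h : ∀ u i v j w, ¬ (u = u₀ ∧ i = i₀ ∧ v = v₀ ∧ j = j₀ ∧ w = w₀) → F u i v j w = 0)
    (l : List (AX g)) :
    sum₂ F l = if u₀ ++ Sum.inr i₀ :: (v₀ ++ Sum.inr j₀ :: w₀) = l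
      then F u₀ i₀ v₀ j₀ w₀ else 0 := by
  split_ifs with hl
  · rw [sum₂, sum₁, Finset.sum_eq_single (u₀, i₀, v₀ ++ Sum.inr j₀ :: w₀), sum₁,
      Finset.sum_eq_single (v₀, j₀, w₀)]
    · intro ρ _ hne
      refine h _ _ _ _ _ fun hh => hne ?_
      obtain ⟨-, -, h3, h4, h5⟩ := hh
      exact Prod.ext h3 (Prod.ext h4 h5)
    · intro hn; exact absurd (mem_splits.2 rfl) hn
    · intro τ hτ hne
      refine Finset.sum_eq_zero fun ρ hρ => h _ _ _ _ _ fun hh => hne ?_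
      obtain ⟨h1, h2, h3, h4, h5⟩ := hh
      refine Prod.ext h1 (Prod.ext h2 ?_)
      rw [← mem_splits.1 hρ, h3, h4, h5]
    · intro hn; exact absurd (mem_splits.2 hl) hn
  · rw [sum₂_congr (F' := fun _ _ _ _ _ => 0), sum₂]
    · simp [sum₁]
    · rintro u i v j w rfl
      refine h _ _ _ _ _ ?_
      rintro ⟨rfl, rfl, rfl, rfl, rfl⟩
      exact hl rfl

/-- The number of `a`-letters of a list. -/
def aDeg (l : List (AX g)) : ℕ := l.countP (fun c => c.isLeft)

/-- The number of `x`-letters of a list. -/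
def xDeg (l : List (AX g)) : ℕ := l.countP (fun c => c.isRight)

@[simp] lemma aDeg_nil : aDeg ([] : List (AX g)) = 0 := rfl
@[simp] lemma xDeg_nil : xDeg ([] : List (AX g)) = 0 := rfl
@[simp] lemma aDeg_cons_inl (k : Fin g) (l : List (AX g)) :
    aDeg (Sum.inl k :: l) = aDeg l + 1 := by simp [aDeg, List.countP_cons]
@[simp] lemma aDeg_cons_inr (k : Fin g) (l : List (AX g)) :
    aDeg (Sum.inr k :: l) = aDeg l := by simp [aDeg]
@[simp] lemma xDeg_cons_inl (k : Fin g) (l : List (AX g)) :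
    xDeg (Sum.inl k :: l) = xDeg l := by simp [xDeg]
@[simp] lemma xDeg_cons_inr (k : Fin g) (l : List (AX g)) :
    xDeg (Sum.inr k :: l) = xDeg l + 1 := by simp [xDeg, List.countP_cons]
@[simp] lemma aDeg_append (l m : List (AX g)) : aDeg (l ++ m) = aDeg l + aDeg m := by
  simp [aDeg]
@[simp] lemma xDeg_append (l m : List (AX g)) : xDeg (l ++ m) = xDeg l + xDeg m := by
  simp [xDeg]
@[simp] lemma aDeg_reverse (l : List (AX g)) : aDeg l.reverse = aDeg l := by simp [aDeg]
@[simp] lemma xDeg_reverse (l : List (AX g)) : xDeg l.reverse = xDeg l := by simp [xDeg]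

lemma sum₁_const (m : M) (l : List (AX g)) : sum₁ (fun _ _ _ => m) l = xDeg l • m := by
  induction l with
  | nil => simp
  | cons c l ih => rcases c with k | k <;> simp [ih, add_smul, add_comm]

/-- Choosing a splitting is choosing two of the `x`-letters; in degree two there is exactly one. -/
lemma sum₂_const (m : M) (l : List (AX g)) :
    sum₂ (fun _ _ _ _ _ => m) l = (xDeg l).choose 2 • m := by
  induction l with
  | nil => simp
  | cons c l ih =>
    rcases c with k | k <;>
      simp [ih, sum₁_const, add_smul, Nat.choose_succ_succ' _ 1]

lemma sum₁_eq_zero {l : List (AX g)} (h : xDeg l = 0)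
    (F : List (AX g) → Fin g → List (AX g) → M) : sum₁ F l = 0 := by
  refine Finset.sum_eq_zero fun τ hτ => ?_
  rw [← mem_splits.1 hτ] at h
  simp at h

lemma sum₂_eq_zero {l : List (AX g)} (h : xDeg l ≤ 1)
    (F : List (AX g) → Fin g → List (AX g) → Fin g → List (AX g) → M) : sum₂ F l = 0 := by
  rw [sum₂_congr (F' := fun _ _ _ _ _ => 0), sum₂]
  · simp [sum₁]
  · rintro u i v j w rfl
    simp at h; omega

end Splits

/-! ### Finite-dimensional spaces of polynomials of bounded degree -/

section Degrees

variable {g : ℕ}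

lemma aDeg_add_xDeg (l : List (AX g)) : aDeg l + xDeg l = l.length := by
  induction l with
  | nil => rfl
  | cons c l ih => rcases c with k | k <;> simp at ih ⊢ <;> omega

/-- Lists of letters with bounded degrees. -/
def boundedLists (g s t : ℕ) : Set (List (AX g)) := {l | aDeg l ≤ s ∧ xDeg l ≤ t}

lemma boundedLists_finite (s t : ℕ) : (boundedLists g s t).Finite :=
  (List.finite_length_le (AX g) (s + t)).subset fun l hl => by
    have := aDeg_add_xDeg l
    have := hl.1
    have := hl.2
    simp only [Set.mem_ofPred_eq]; omega

/-- Polynomials of degree at most `s` in `a` and at most `t` in `x`. -/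
def boundedPolys (g s t : ℕ) : Submodule ℝ (NCPoly (AX g)) :=
  (Finsupp.supported ℝ ℝ (boundedLists g s t)).comap coeffs.toLinearMap

lemma mem_boundedPolys {s t : ℕ} {q : NCPoly (AX g)} :
    q ∈ boundedPolys g s t ↔ ∀ l, coeffs q l ≠ 0 → aDeg l ≤ s ∧ xDeg l ≤ t := by
  simp [boundedPolys, Finsupp.mem_supported, Set.subset_def, boundedLists]

lemma degA_le_iff {q : NCPoly (AX g)} {s : ℕ} :
    degA q ≤ s ↔ ∀ l, coeffs q l ≠ 0 → aDeg l ≤ s := by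
  simp only [degA, Finset.sup_le_iff, mem_words_iff]
  rfl

lemma degX_le_iff {q : NCPoly (AX g)} {t : ℕ} :
    degX q ≤ t ↔ ∀ l, coeffs q l ≠ 0 → xDeg l ≤ t := by
  simp only [degX, Finset.sup_le_iff, mem_words_iff]
  rfl

lemma mem_boundedPolys_iff_deg {s t : ℕ} {q : NCPoly (AX g)} :
    q ∈ boundedPolys g s t ↔ degA q ≤ s ∧ degX q ≤ t := by
  rw [mem_boundedPolys, degA_le_iff, degX_le_iff]
  exact ⟨fun h => ⟨fun l hl => (h l hl).1, fun l hl => (h l hl).2⟩,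
    fun h l hl => ⟨h.1 l hl, h.2 l hl⟩⟩

instance (s t : ℕ) : FiniteDimensional ℝ (boundedPolys g s t) := by
  have : Finite (boundedLists g s t) := boundedLists_finite s t
  have e : Finsupp.supported ℝ ℝ (boundedLists g s t) ≃ₗ[ℝ] (boundedLists g s t →₀ ℝ) :=
    Finsupp.supportedEquivFinsupp _
  have : FiniteDimensional ℝ (Finsupp.supported ℝ ℝ (boundedLists g s t)) :=
    e.symm.finiteDimensional
  have : boundedPolys g s t
      = (Finsupp.supported ℝ ℝ (boundedLists g s t)).map coeffs.symm.toLinearMap := by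
    ext q; simp [boundedPolys, Submodule.mem_map_equiv]
  rw [this]
  infer_instance

lemma mono_mem_boundedPolys {s t : ℕ} {l : List (AX g)} (hs : aDeg l ≤ s) (ht : xDeg l ≤ t) :
    mono l ∈ boundedPolys g s t := by
  classical
  rw [mem_boundedPolys]
  intro m hm
  rw [coeffs_mono, Finsupp.single_apply] at hm
  have : l = m := by by_contra h; simp [h] at hm
  exact this ▸ ⟨hs, ht⟩

end Degrees

/-! ### A separating point of the domain -/

/-- If no nonzero polynomial in a finite-dimensional space vanishes on a domain, then some point of
the domain and some vector separate all of them. -/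
lemma exists_separating {σ : Type} (W : NCDomain σ) (Q : Submodule ℝ (NCPoly σ))
    [FiniteDimensional ℝ Q]
    (hQ : ∀ q ∈ Q, (∀ (n : ℕ), ∀ Y ∈ W.level n, eval Y q = 0) → q = 0)
    (hne : ∃ n, (W.level n).Nonempty) :
    ∃ (n : ℕ) (Y : SymTuple σ n) (v : Fin n → ℝ), Y ∈ W.level n ∧
      ∀ q ∈ Q, (eval Y q).mulVec v = 0 → q = 0 := by
  let f (n : ℕ) (Y : SymTuple σ n) (v : Fin n → ℝ) : Q →ₗ[ℝ] (Fin n → ℝ) :=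
    { toFun := fun q => (eval Y q.1).mulVec v
      map_add' := fun a b => by simp [eval_add, Matrix.add_mulVec]
      map_smul' := fun c a => by
        simp only [Submodule.coe_smul, ← evalₗ_apply, map_smul, Matrix.smul_mulVec,
          RingHom.id_apply] }
  obtain ⟨n₀, Y₀, hY₀⟩ := hne
  obtain ⟨K, ⟨n, Y, v, hY, rfl⟩, hmin⟩ := IsArtinian.set_has_minimal
    {K : Submodule ℝ Q | ∃ n Y v, Y ∈ W.level n ∧ K = LinearMap.ker (f n Y v)}
    ⟨_, n₀, Y₀, 0, hY₀, rfl⟩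
  refine ⟨n, Y, v, hY, fun q hq hqv => hQ q hq fun m Z hZ => ?_⟩
  -- Passing to a direct sum intersects the two kernels, so the minimal kernel lies in the kernel of
  -- every other point and vector.
  have key : ∀ w, (eval Z q).mulVec w = 0 := by
    intro w
    have hle : LinearMap.ker (f (n + m) (fun i => dsum (Y i) (Z i)) (vsum v w))
        = LinearMap.ker (f n Y v) ⊓ LinearMap.ker (f m Z w) := by
      ext r
      have h0 : (0 : Fin (n + m) → ℝ) = vsum 0 0 := by
        ext i; simp only [vsum, Function.comp, Pi.zero_apply]
        cases finSumFinEquiv.symm i <;> rfl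
      change (eval _ r.1).mulVec _ = 0 ↔ (eval Y r.1).mulVec v = 0 ∧ (eval Z r.1).mulVec w = 0
      rw [eval_dsum_mulVec, h0, vsum_inj]
    have hnot := hmin _ ⟨_, _, vsum v w, W.dsum_mem hY hZ, rfl⟩
    rw [hle] at hnot
    have heq : LinearMap.ker (f n Y v) ⊓ LinearMap.ker (f m Z w) = LinearMap.ker (f n Y v) :=
      (lt_or_eq_of_le inf_le_left).resolve_left hnot
    have : (⟨q, hq⟩ : Q) ∈ LinearMap.ker (f n Y v) := hqv
    rw [← heq] at this
    exact this.2
  ext i j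
  simpa using congrFun (key (Pi.single j 1)) i

variable {g : ℕ}

/-! ### The Hessian as a form in border vectors -/

section Hessian

/-- The partial Hessian as a linear map. -/
def partialHessianₗ : NCPoly (AX g) →ₗ[ℝ] NCPoly (AXH g) where
  toFun := partialHessian
  map_add' p q := by simp [partialHessian, lineX]
  map_smul' c p := by simp [partialHessian, lineX]

lemma partialHessian_eq_coeff (p : NCPoly (AX g)) :
    partialHessian p = (2 : ℝ) • (lineX p).coeff 2 := by
  rw [partialHessian, ← Polynomial.coeff_zero_eq_eval_zero, Polynomial.coeff_derivative,
    Polynomial.coeff_derivative, Algebra.smul_def, Algebra.commutes]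
  norm_num
  exact Or.inl (map_ofNat (algebraMap ℝ (NCPoly (AXH g))) 2).symm

/-- The three orders must be proved together: a new leading `x_k` multiplies by `x_k + t h_k`, so
order 0 feeds into order 1 and order 1 into order 2. -/
lemma eval_coeff_lineX_mono {n : ℕ} (A X H : SymTuple (Fin g) n) (l : List (AX g)) :
    eval (Sum.elim A (Sum.elim X H)) ((lineX (mono l)).coeff 0) = eval (pair A X) (mono l) ∧
    eval (Sum.elim A (Sum.elim X H)) ((lineX (mono l)).coeff 1)
      = sum₁ (fun u j w => eval (pair A X) (mono u) * (H j : Matrix _ _ ℝ)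
          * eval (pair A X) (mono w)) l ∧
    eval (Sum.elim A (Sum.elim X H)) ((lineX (mono l)).coeff 2)
      = sum₂ (fun u i v j w => eval (pair A X) (mono u) * (H i : Matrix _ _ ℝ)
          * (eval (pair A X) (mono v) * (H j : Matrix _ _ ℝ) * eval (pair A X) (mono w))) l := by
  have hm (c : AX g) (l) : lineX (mono (c :: l)) = lineX (FreeAlgebra.ι ℝ c) * lineX (mono l) := by
    simp [lineX]
  have hs₁ (B : Matrix (Fin n) (Fin n) ℝ) (F : List (AX g) → Fin g → List (AX g) →
      Matrix (Fin n) (Fin n) ℝ) (l) : B * sum₁ F l = sum₁ (fun u j w => B * F u j w) l :=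
    map_sum₁ (AddMonoidHom.mulLeft B) F l
  have hs₂ (B : Matrix (Fin n) (Fin n) ℝ) (F : List (AX g) → Fin g → List (AX g) → Fin g →
      List (AX g) → Matrix (Fin n) (Fin n) ℝ) (l) :
      B * sum₂ F l = sum₂ (fun u i v j w => B * F u i v j w) l :=
    map_sum₂ (AddMonoidHom.mulLeft B) F l
  induction l with
  | nil => simp [lineX, Polynomial.coeff_one, eval]
  | cons c l ih =>
    obtain ⟨h0, h1, h2⟩ := ih
    rw [hm]
    rcases c with k | k
    · simp [lineX] at h0 h1 h2 ⊢
      simp [eval_mul, h0, h1, h2, hs₁, hs₂, mul_assoc]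
    · have e : lineX (FreeAlgebra.ι ℝ (Sum.inr k : AX g))
          = Polynomial.C (FreeAlgebra.ι ℝ (Sum.inr (Sum.inl k)))
            + Polynomial.X * Polynomial.C (FreeAlgebra.ι ℝ (Sum.inr (Sum.inr k))) := by
        simp [lineX]
      have hX1 (q : Polynomial (NCPoly (AXH g))) : (Polynomial.X * q).coeff 1 = q.coeff 0 :=
        Polynomial.coeff_X_mul q 0
      have hX2 (q : Polynomial (NCPoly (AXH g))) : (Polynomial.X * q).coeff 2 = q.coeff 1 :=
        Polynomial.coeff_X_mul q 1
      rw [e, add_mul, mul_assoc]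
      simp only [Polynomial.coeff_add, Polynomial.coeff_C_mul, Polynomial.coeff_X_mul_zero,
        hX1, hX2, eval_add, eval_mul, h0, h1, h2,
        eval_ι, Sum.elim_inl, Sum.elim_inr, sum₁_cons_inr, sum₂_cons_inr, mono_cons, mono_nil,
        eval_one, one_mul, hs₁, hs₂, mul_assoc, add_zero]
      exact ⟨trivial, add_comm _ _, add_comm _ _⟩

lemma hessianAt_eq_wordSum {n : ℕ} (p : NCPoly (AX g)) (A X H : SymTuple (Fin g) n) :
    hessianAt p A X H = (2 : ℝ) • wordSum (sum₂ fun u i v j w =>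
      eval (pair A X) (mono u) * (H i : Matrix _ _ ℝ)
          * (eval (pair A X) (mono v) * (H j : Matrix _ _ ℝ) * eval (pair A X) (mono w))) p := by
  have := linearMap_eq_wordSum (evalₗ (Sum.elim A (Sum.elim X H)) ∘ₗ partialHessianₗ) p
  change hessianAt p A X H = _ at this
  rw [this, wordSum_apply, wordSum_apply, Finset.smul_sum]
  refine Finset.sum_congr rfl fun l _ => ?_
  rw [smul_comm (2 : ℝ), ← (eval_coeff_lineX_mono A X H l).2.2]
  congr 1
  change eval _ (partialHessian _) = _
  rw [partialHessian_eq_coeff, ← evalₗ_apply, map_smul, evalₗ_apply]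

/-- The form `∑ ⟨v(Y) η_{j,w}, ξ_{i,u*}⟩`, weighted by the coefficients of `u x_i v x_j w` in `p`. -/
def formₗ {n : ℕ} (Y : SymTuple (AX g) n) (ξ η : Fin g → List (AX g) → Fin n → ℝ) :
    NCPoly (AX g) →ₗ[ℝ] ℝ :=
  wordSum (sum₂ fun u i v j w => ξ i u.reverse ⬝ᵥ (eval Y (mono v)).mulVec (η j w))

/-- Since `H i` is symmetric and the transpose of `u` is its reversal, `u H_i` moves to the left
argument as `H_i u*`. Both sides then carry border vectors of the same shape. -/
lemma dotProduct_wordSum_mulVec {n : ℕ} (p : NCPoly (AX g)) (A X H : SymTuple (Fin g) n)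
    (z : Fin n → ℝ) :
    z ⬝ᵥ (wordSum (sum₂ fun u i v j w =>
      eval (pair A X) (mono u) * (H i : Matrix _ _ ℝ)
          * (eval (pair A X) (mono v) * (H j : Matrix _ _ ℝ) * eval (pair A X) (mono w)))
            p).mulVec z
      = formₗ (pair A X) (fun j w => (H j : Matrix _ _ ℝ).mulVec
            ((eval (pair A X) (mono w)).mulVec z))
          (fun j w => (H j : Matrix _ _ ℝ).mulVec ((eval (pair A X) (mono w)).mulVec z)) p := by
  let q : Matrix (Fin n) (Fin n) ℝ →ₗ[ℝ] ℝ :=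
    { toFun := fun M => z ⬝ᵥ M.mulVec z
      map_add' := fun a b => by simp [Matrix.add_mulVec]
      map_smul' := fun c a => by simp [Matrix.smul_mulVec] }
  change q _ = _
  rw [formₗ, wordSum_apply, wordSum_apply, map_sum]
  refine Finset.sum_congr rfl fun l _ => ?_
  rw [map_smul]
  congr 1
  refine (map_sum₂ q.toAddMonoidHom _ l).trans (sum₂_congr fun u i v j w _ => ?_)
  change z ⬝ᵥ Matrix.mulVec _ z = _
  have hH : (H i : Matrix (Fin n) (Fin n) ℝ).transpose = H i := (H i).2
  rw [← star_mono, eval_star]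
  conv_rhs => rw [← hH]
  simp only [← Matrix.mulVec_mulVec, Matrix.mulVec_transpose, ← Matrix.dotProduct_mulVec]

lemma dotProduct_hessianAt_mulVec {n : ℕ} (p : NCPoly (AX g)) (A X H : SymTuple (Fin g) n)
    (z : Fin n → ℝ) :
    z ⬝ᵥ (hessianAt p A X H).mulVec z
      = 2 * formₗ (pair A X) (fun j w => (H j : Matrix _ _ ℝ).mulVec
            ((eval (pair A X) (mono w)).mulVec z))
          (fun j w => (H j : Matrix _ _ ℝ).mulVec ((eval (pair A X) (mono w)).mulVec z)) p := by
  rw [hessianAt_eq_wordSum, ← dotProduct_wordSum_mulVec]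
  simp [Matrix.smul_mulVec]

lemma formₗ_congr {n m : ℕ} {p : NCPoly (AX g)} {Y : SymTuple (AX g) n} {Z : SymTuple (AX g) m}
    {ξ η : Fin g → List (AX g) → Fin n → ℝ} {ξ' η' : Fin g → List (AX g) → Fin m → ℝ}
    (h : ∀ u i v j w, coeffs p (u ++ Sum.inr i :: (v ++ Sum.inr j :: w)) ≠ 0 →
      ξ i u.reverse ⬝ᵥ (eval Y (mono v)).mulVec (η j w)
        = ξ' i u.reverse ⬝ᵥ (eval Z (mono v)).mulVec (η' j w)) :
    formₗ Y ξ η p = formₗ Z ξ' η' p :=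
  wordSum_congr fun _ hl => sum₂_congr fun u i v j w huv => h u i v j w (huv ▸ hl)

lemma formₗ_smul_add {n : ℕ} (p : NCPoly (AX g)) (Y : SymTuple (AX g) n) (s : ℝ)
    (ξ η : Fin g → List (AX g) → Fin n → ℝ) :
    formₗ Y (s • ξ + η) (s • ξ + η) p = s ^ 2 * formₗ Y ξ ξ p
      + s * (formₗ Y ξ η p + formₗ Y η ξ p) + formₗ Y η η p := by
  have : formₗ Y (s • ξ + η) (s • ξ + η) = s ^ 2 • formₗ Y ξ ξ
      + s • (formₗ Y ξ η + formₗ Y η ξ) + formₗ Y η η := by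
    refine linearMap_ext_mono fun l => ?_
    simp only [formₗ, LinearMap.add_apply, LinearMap.smul_apply, wordSum_mono, sum₂, sum₁,
      Finset.smul_sum, ← Finset.sum_add_distrib]
    refine Finset.sum_congr rfl fun τ _ => Finset.sum_congr rfl fun ρ _ => ?_
    simp only [Pi.add_apply, Pi.smul_apply, Matrix.mulVec_add, Matrix.mulVec_smul,
      dotProduct_add, add_dotProduct, smul_dotProduct, dotProduct_smul, smul_eq_mul]
    ring
  simp [this, mul_add]

end Hessian

/-! ### Positivity of the middle form -/

/-- The off-diagonal symmetric block matrix with upper right corner `Γ`. -/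
def offDiag {n m : ℕ} (Γ : Matrix (Fin n) (Fin m) ℝ) : SymMat (n + m) :=
  ⟨Matrix.reindex finSumFinEquiv finSumFinEquiv (Matrix.fromBlocks 0 Γ Γ.transpose 0),
    (Matrix.IsSymm.fromBlocks Matrix.isSymm_zero (by simp) Matrix.isSymm_zero).submatrix _⟩

lemma dsum_pair {n m : ℕ} (A X : SymTuple (Fin g) n) (B Z : SymTuple (Fin g) m) :
    (fun i => dsum (pair A X i) (pair B Z i))
      = pair (fun i => dsum (A i) (B i)) (fun i => dsum (X i) (Z i)) := by
  funext i; cases i <;> rfl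

/-- A positive semidefinite Hessian and one separating point give positivity of the middle form. -/
lemma formₗ_nonneg {p : NCPoly (AX g)} {W : NCDomain (AX g)} (hW : HessianPosSemidefOn p W)
    {m : ℕ} {Z : SymTuple (AX g) m} (hZ : Z ∈ W.level m) {v₀ : Fin m → ℝ}
    (hsep : ∀ q ∈ boundedPolys g (degA p) (degX p - 2), (eval Z q).mulVec v₀ = 0 → q = 0)
    {n : ℕ} {Y : SymTuple (AX g) n} (hY : Y ∈ W.level n)
    (ξ : Fin g → List (AX g) → Fin n → ℝ) : 0 ≤ formₗ Y ξ ξ p := by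
  obtain ⟨A, X, rfl⟩ : ∃ A X, Y = pair A X := ⟨_, _, (Sum.elim_comp_inl_inr Y).symm⟩
  obtain ⟨B, X', rfl⟩ : ∃ A X, Z = pair A X := ⟨_, _, (Sum.elim_comp_inl_inr Z).symm⟩
  let f : boundedPolys g (degA p) (degX p - 2) →ₗ[ℝ] (Fin m → ℝ) :=
    { toFun := fun q => (eval (pair B X') q.1).mulVec v₀
      map_add' := fun a b => by simp [eval_add, Matrix.add_mulVec]
      map_smul' := fun c a => by
        simp only [Submodule.coe_smul, ← evalₗ_apply, map_smul, Matrix.smul_mulVec,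
          RingHom.id_apply] }
  obtain ⟨f', hf'⟩ := f.exists_leftInverse_of_injective (LinearMap.ker_eq_bot'.2 fun q hq =>
    Subtype.ext (hsep q.1 q.2 hq))
  -- Recover the polynomial from its value at `v₀` by the left inverse `f'`, then send each word `w`
  -- to `ξ j w`.
  let Γ (j : Fin g) : Matrix (Fin n) (Fin m) ℝ :=
    LinearMap.toMatrix' ((wordSum (ξ j) ∘ₗ Submodule.subtype _) ∘ₗ f')
  have hΓ (j : Fin g) (w : List (AX g)) (hw : mono w ∈ boundedPolys g (degA p) (degX p - 2)) :
      (Γ j).mulVec ((eval (pair B X') (mono w)).mulVec v₀) = ξ j w := by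
    have : f' (f ⟨mono w, hw⟩) = ⟨mono w, hw⟩ := LinearMap.congr_fun hf' _
    change f' ((eval (pair B X') (mono w)).mulVec v₀) = _ at this
    rw [LinearMap.toMatrix'_mulVec, LinearMap.comp_apply, this]
    simp
  have hmem := W.dsum_mem hY hZ
  rw [dsum_pair] at hmem
  -- At `0 ⊕ v₀` border words see only the separating point; `offDiag` then moves the vectors into
  -- the first block, where the middle word is evaluated at `Y`.
  have h0 := (hW _ _ _ hmem fun j => offDiag (Γ j)).dotProduct_mulVec_nonneg (vsum 0 v₀)
  rw [star_trivial, dotProduct_hessianAt_mulVec, ← dsum_pair] at h0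
  have h1 := nonneg_of_mul_nonneg_right h0 two_pos
  refine h1.trans_eq (formₗ_congr fun u i v j w hc => ?_)
  have hb (j : Fin g) (w : List (AX g)) (hs : aDeg w ≤ degA p) (ht : xDeg w ≤ degX p - 2) :
      (offDiag (Γ j) : Matrix (Fin (n + m)) (Fin (n + m)) ℝ).mulVec ((eval (fun i => dsum (pair A X i) (pair B X' i))
        (mono w)).mulVec (vsum 0 v₀)) = vsum (ξ j w) 0 := by
    rw [eval_dsum_mulVec, offDiag, reindex_fromBlocks_mulVec, hΓ j w (mono_mem_boundedPolys hs ht)]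
    simp
  have ha := degA_le_iff.1 le_rfl _ hc
  have hx := degX_le_iff.1 le_rfl _ hc
  simp only [aDeg_append, aDeg_cons_inr, xDeg_append, xDeg_cons_inr] at ha hx
  -- The two distinguished `x`-letters account for the `- 2`, so both border words are within the
  -- bounds.
  rw [hb j w (by omega) (by omega), hb i u.reverse (by simp; omega) (by simp; omega),
    eval_dsum_mulVec, vsum_dotProduct]
  simp

/-! ### Entries of the middle matrix and the degree bound -/

section Middle

/-- The entry of the middle matrix of `p` at a pair of border words. -/
def middle (κ κ' : Fin g × List (AX g)) : NCPoly (AX g) →ₗ[ℝ] NCPoly (AX g) :=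
  open Classical in
  wordSum (sum₂ fun u i v j w => if (i, u.reverse) = κ ∧ (j, w) = κ' then mono v else 0)

/-- The family of vectors supported at one border word. -/
def border {n : ℕ} (κ : Fin g × List (AX g)) (z : Fin n → ℝ) : Fin g → List (AX g) → Fin n → ℝ :=
  open Classical in fun j w => if (j, w) = κ then z else 0

lemma formₗ_border {n : ℕ} (Y : SymTuple (AX g) n) (κ κ' : Fin g × List (AX g))
    (z z' : Fin n → ℝ) (p : NCPoly (AX g)) :
    formₗ Y (border κ z) (border κ' z') p = z ⬝ᵥ (eval Y (middle κ κ' p)).mulVec z' := by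
  let q : Matrix (Fin n) (Fin n) ℝ →ₗ[ℝ] ℝ :=
    { toFun := fun M => z ⬝ᵥ M.mulVec z'
      map_add' := fun a b => by simp [Matrix.add_mulVec]
      map_smul' := fun c a => by simp [Matrix.smul_mulVec] }
  have : formₗ Y (border κ z) (border κ' z') = (q ∘ₗ evalₗ Y) ∘ₗ middle κ κ' := by
    refine linearMap_ext_mono fun l => ?_
    simp only [formₗ, LinearMap.comp_apply, middle, wordSum_mono]
    refine Eq.symm ((map_sum₂ (q ∘ₗ evalₗ Y).toAddMonoidHom _ l).trans
      (sum₂_congr fun u i v j w _ => ?_))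
    by_cases h : (i, u.reverse) = κ <;> by_cases h' : (j, w) = κ' <;> simp [border, h, h', q]
  exact LinearMap.congr_fun this p

/-- Each coefficient of an entry is a single coefficient of `p`, so no cancellation can occur inside
an entry. -/
lemma coeffs_middle (i : Fin g) (u : List (AX g)) (j : Fin g) (w v : List (AX g))
    (p : NCPoly (AX g)) :
    coeffs (middle (i, u) (j, w) p) v
      = coeffs p (u.reverse ++ Sum.inr i :: (v ++ Sum.inr j :: w)) := by
  classical
  let c (v : List (AX g)) : NCPoly (AX g) →ₗ[ℝ] ℝ := Finsupp.lapply v ∘ₗ coeffs.toLinearMap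
  have : c v ∘ₗ middle (i, u) (j, w) = c (u.reverse ++ Sum.inr i :: (v ++ Sum.inr j :: w)) := by
    refine linearMap_ext_mono fun l => ?_
    simp only [LinearMap.comp_apply, middle, wordSum_mono]
    refine (map_sum₂ (c v).toAddMonoidHom _ l).trans ?_
    rw [sum₂_indicator u.reverse i v j w]
    · simp [c, Finsupp.single_apply, eq_comm]
    · intro u' i' v' j' w' hne
      simp only [Prod.mk.injEq, List.reverse_eq_iff]
      split_ifs with hh
      · obtain ⟨⟨rfl, rfl⟩, rfl, rfl⟩ := hh
        have : v' ≠ v := fun hv => hne ⟨rfl, rfl, hv, rfl, rfl⟩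
        simp [c, this]
      · simp
  exact LinearMap.congr_fun this p

lemma middle_mem_boundedPolys (κ κ' : Fin g × List (AX g)) (p : NCPoly (AX g)) :
    middle κ κ' p ∈ boundedPolys g (degA p) (degX p - 2) := by
  obtain ⟨i, u⟩ := κ
  obtain ⟨j, w⟩ := κ'
  rw [mem_boundedPolys]
  intro v hv
  rw [coeffs_middle] at hv
  have ha := degA_le_iff.1 le_rfl _ hv
  have hx := degX_le_iff.1 le_rfl _ hv
  simp only [aDeg_append, aDeg_cons_inr, xDeg_append, xDeg_cons_inr] at ha hx
  omega

lemma star_mem_boundedPolys {s t : ℕ} {q : NCPoly (AX g)} (hq : q ∈ boundedPolys g s t) :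
    star q ∈ boundedPolys g s t := by
  rw [mem_boundedPolys] at hq ⊢
  intro l hl
  rw [coeffs_star] at hl
  simpa using hq _ hl

lemma exists_split_of_xDeg_pos {l : List (AX g)} (h : 0 < xDeg l) :
    ∃ u j w, l = u ++ Sum.inr j :: w ∧ xDeg u = 0 := by
  induction l with
  | nil => simp at h
  | cons c l ih =>
    rcases c with k | k
    · obtain ⟨u, j, w, rfl, hu⟩ := ih (by simpa using h)
      exact ⟨Sum.inl k :: u, j, w, rfl, by simpa using hu⟩
    · exact ⟨[], k, l, rfl, rfl⟩

/-- If the middle form is positive on the domain and no nonzero polynomial of small degree vanishes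
there, then `p` has degree at most two in `x`. -/
lemma degX_le_two {p : NCPoly (AX g)} (hp : star p = p) {W : NCDomain (AX g)}
    (hpos : ∀ (n : ℕ), ∀ Y ∈ W.level n, ∀ ξ, 0 ≤ formₗ Y ξ ξ p)
    (hne : ∀ q ∈ boundedPolys g (degA p) (degX p - 2),
      (∀ (n : ℕ), ∀ Y ∈ W.level n, eval Y q = 0) → q = 0) : degX p ≤ 2 := by
  by_contra! hd
  obtain ⟨l, hl, hlx⟩ : ∃ l, coeffs p l ≠ 0 ∧ degX p ≤ xDeg l := by
    by_contra! hcon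
    have : degX p ≤ degX p - 1 := degX_le_iff.2 fun l hl => by have := hcon l hl; omega
    omega
  have hlx' : xDeg l = degX p := le_antisymm (degX_le_iff.1 le_rfl l hl) hlx
  obtain ⟨u, i, r, rfl, hu⟩ := exists_split_of_xDeg_pos (l := l) (by omega)
  obtain ⟨v, j, w, rfl, hv⟩ := exists_split_of_xDeg_pos (l := r) (by simp [hu] at hlx'; omega)
  simp only [xDeg_append, xDeg_cons_inr, hu, hv] at hlx'
  let κ : Fin g × List (AX g) := (i, u.reverse)
  let κ' : Fin g × List (AX g) := (j, w)
  -- Here `w` has `x`-degree `degX p - 2`, so a word `w* x_j v' x_j w` has `x`-degree at least `2 *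
  -- degX p - 2`, which exceeds `degX p`.
  have hzero : middle κ' κ' p = 0 := by
    apply coeffs.injective
    ext v'
    rw [coeffs_middle]
    by_contra hc
    rw [map_zero, Finsupp.zero_apply] at hc
    have hx := degX_le_iff.1 le_rfl _ hc
    simp only [xDeg_append, xDeg_cons_inr, xDeg_reverse] at hx
    omega
  have hvan : middle κ κ' p + star (middle κ' κ p) = 0 := by
    refine hne _ (add_mem (middle_mem_boundedPolys _ _ _)
      (star_mem_boundedPolys (middle_mem_boundedPolys _ _ _))) fun n Y hY => ?_
    have key (z z' : Fin n → ℝ) : z ⬝ᵥ (eval Y (middle κ κ' p + star (middle κ' κ p))).mulVec z'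
        = 0 := by
      have h1 : z ⬝ᵥ (eval Y (middle κ κ' p + star (middle κ' κ p))).mulVec z'
          = formₗ Y (border κ z) (border κ' z') p + formₗ Y (border κ' z') (border κ z) p := by
        rw [formₗ_border, formₗ_border, eval_add, eval_star, Matrix.add_mulVec, dotProduct_add,
          Matrix.mulVec_transpose, dotProduct_comm z (Matrix.vecMul _ _),
          ← Matrix.dotProduct_mulVec]
      -- The `s ^ 2` term is absent by `hzero`; an affine function of `s` that is nonnegative
      -- everywhere has slope zero.
      have h2 (s : ℝ) : 0 ≤ s * (formₗ Y (border κ z) (border κ' z') p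
          + formₗ Y (border κ' z') (border κ z) p) + formₗ Y (border κ z) (border κ z) p := by
        have := hpos n Y hY (s • border κ' z' + border κ z)
        rw [formₗ_smul_add, formₗ_border Y κ' κ', hzero] at this
        have e0 : eval Y (0 : NCPoly (AX g)) = 0 := map_zero (evalₗ Y)
        simp only [e0, Matrix.zero_mulVec, dotProduct_zero, mul_zero, zero_add] at this
        linarith
      rw [h1]
      by_contra hc
      set b := formₗ Y (border κ z) (border κ' z') p + formₗ Y (border κ' z') (border κ z) p
      -- This `s` makes the affine function equal to `-1`.
      have := h2 (-(formₗ Y (border κ z) (border κ z) p + 1) / b)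
      rw [div_mul_cancel₀ _ hc] at this
      linarith
    ext a b
    simpa using key (Pi.single a 1) (Pi.single b 1)
  have hcoef := DFunLike.congr_fun (congrArg coeffs hvan) v
  rw [map_add, Finsupp.add_apply, coeffs_star, coeffs_middle, coeffs_middle] at hcoef
  have hsym : coeffs p (w.reverse ++ Sum.inr j :: (v.reverse ++ Sum.inr i :: u.reverse))
      = coeffs p (u ++ Sum.inr i :: (v ++ Sum.inr j :: w)) := by
    conv_lhs => rw [← hp, coeffs_star]
    simp
  rw [hsym, List.reverse_reverse, map_zero, Finsupp.zero_apply] at hcoef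
  exact hl (by linarith)

end Middle

/-! ### Global convexity in degree two -/

section Convexity

lemma eval_pair_of_xDeg_eq_zero {n : ℕ} (A X X' : SymTuple (Fin g) n) {l : List (AX g)}
    (h : xDeg l = 0) : eval (pair A X) (mono l) = eval (pair A X') (mono l) := by
  induction l with
  | nil => simp
  | cons c l ih =>
    rcases c with k | k
    · simp [eval_mul, ih (by simpa using h)]
    · simp at h

lemma eval_pair_line_of_xDeg_le_one {n : ℕ} (A X H : SymTuple (Fin g) n) (s : ℝ)
    {l : List (AX g)} (h : xDeg l ≤ 1) :
    eval (pair A (X + s • H)) (mono l) = eval (pair A X) (mono l)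
      + s • sum₁ (fun u j w => eval (pair A X) (mono u) * (H j : Matrix _ _ ℝ)
          * eval (pair A X) (mono w)) l := by
  have hs₁ (B : Matrix (Fin n) (Fin n) ℝ) (F : List (AX g) → Fin g → List (AX g) →
      Matrix (Fin n) (Fin n) ℝ) (l) : sum₁ (fun u j w => B * F u j w) l = B * sum₁ F l :=
    (map_sum₁ (AddMonoidHom.mulLeft B) F l).symm
  induction l with
  | nil => simp
  | cons c l ih =>
    rcases c with k | k
    · simp [eval_mul, ih (by simpa using h), mul_assoc, hs₁, mul_add]
    · have h0 : xDeg l = 0 := by simpa using h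
      simp [eval_mul, eval_pair_of_xDeg_eq_zero A (X + s • H) X h0, sum₁_eq_zero h0, add_mul]

lemma eval_pair_line_of_xDeg_le_two {n : ℕ} (A X H : SymTuple (Fin g) n) (s : ℝ)
    {l : List (AX g)} (h : xDeg l ≤ 2) :
    eval (pair A (X + s • H)) (mono l) = eval (pair A X) (mono l)
      + s • sum₁ (fun u j w => eval (pair A X) (mono u) * (H j : Matrix _ _ ℝ)
          * eval (pair A X) (mono w)) l
      + s ^ 2 • sum₂ (fun u i v j w => eval (pair A X) (mono u) * (H i : Matrix _ _ ℝ)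
          * (eval (pair A X) (mono v) * (H j : Matrix _ _ ℝ)
            * eval (pair A X) (mono w))) l := by
  have hs₁ (B : Matrix (Fin n) (Fin n) ℝ) (F : List (AX g) → Fin g → List (AX g) →
      Matrix (Fin n) (Fin n) ℝ) (l) : sum₁ (fun u j w => B * F u j w) l = B * sum₁ F l :=
    (map_sum₁ (AddMonoidHom.mulLeft B) F l).symm
  have hs₂ (B : Matrix (Fin n) (Fin n) ℝ) (F : List (AX g) → Fin g → List (AX g) → Fin g →
      List (AX g) → Matrix (Fin n) (Fin n) ℝ) (l) :
      sum₂ (fun u i v j w => B * F u i v j w) l = B * sum₂ F l :=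
    (map_sum₂ (AddMonoidHom.mulLeft B) F l).symm
  induction l with
  | nil => simp
  | cons c l ih =>
    rcases c with k | k
    · simp [eval_mul, ih (by simpa using h), mul_assoc, hs₁, hs₂, mul_add]
    · have h0 : xDeg l ≤ 1 := by simpa using h
      simp only [mono_cons, eval_mul, eval_pair_line_of_xDeg_le_one A X H s h0, sum₁_cons_inr,
        sum₂_cons_inr, sum₂_eq_zero h0, mul_assoc, hs₁]
      simp [mul_add, add_mul, pow_two, mul_smul]
      abel

lemma eval_pair_line {n : ℕ} {p : NCPoly (AX g)} (hd : degX p ≤ 2) (A X H : SymTuple (Fin g) n)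
    (s : ℝ) :
    eval (pair A (X + s • H)) p = eval (pair A X) p
      + s • wordSum (sum₁ fun u j w => eval (pair A X) (mono u) * (H j : Matrix _ _ ℝ)
          * eval (pair A X) (mono w)) p
      + s ^ 2 • wordSum (sum₂ fun u i v j w => eval (pair A X) (mono u) * (H i : Matrix _ _ ℝ)
          * (eval (pair A X) (mono v) * (H j : Matrix _ _ ℝ)
            * eval (pair A X) (mono w))) p := by
  rw [← evalₗ_apply, ← evalₗ_apply, linearMap_eq_wordSum, linearMap_eq_wordSum (evalₗ (pair A X))]
  simp only [wordSum_apply, Finset.smul_sum, ← Finset.sum_add_distrib]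
  refine Finset.sum_congr rfl fun l hl => ?_
  rw [evalₗ_apply, evalₗ_apply,
    eval_pair_line_of_xDeg_le_two A X H s (degX_le_iff.1 hd l (by simpa using hl)), smul_add,
    smul_add, smul_comm s, smul_comm (s ^ 2)]

/-- One base point `X₀` suffices, because in degree two the middle words involve only `A`. -/
lemma globallyConvexAt_of_formₗ_nonneg {n : ℕ} {p : NCPoly (AX g)} (hp : star p = p)
    (hd : degX p ≤ 2) (A X₀ : SymTuple (Fin g) n) (hpos : ∀ ξ, 0 ≤ formₗ (pair A X₀) ξ ξ p) :
    GloballyConvexAt p A := by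
  intro X Y t ht ht'
  set H := Y - X with hH
  have h1 := eval_pair_line hd A X H 1
  have h2 := eval_pair_line hd A X H (1 - t)
  rw [one_smul, show X + H = Y by rw [hH, add_sub_cancel]] at h1
  rw [show X + (1 - t) • H = t • X + (1 - t) • Y by rw [hH]; module] at h2
  refine Matrix.PosSemidef.of_dotProduct_mulVec_nonneg ?_ fun z => ?_
  · rw [Matrix.IsHermitian, Matrix.conjTranspose_eq_transpose_of_trivial]
    simp [fun Y : SymTuple (AX g) n => (eval_isSymm Y hp).eq]
  · set F₂ := wordSum (sum₂ fun u i v j w => eval (pair A X) (mono u) * (H i : Matrix _ _ ℝ)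
      * (eval (pair A X) (mono v) * (H j : Matrix _ _ ℝ) * eval (pair A X) (mono w))) p with hF₂
    have hz : 0 ≤ z ⬝ᵥ F₂.mulVec z := by
      rw [hF₂, dotProduct_wordSum_mulVec]
      refine (hpos fun j w => (H j : Matrix _ _ ℝ).mulVec
        ((eval (pair A X) (mono w)).mulVec z)).trans_eq (formₗ_congr fun u i v j w hc => ?_)
      have hx := degX_le_iff.1 hd _ hc
      simp only [xDeg_append, xDeg_cons_inr] at hx
      rw [eval_pair_of_xDeg_eq_zero A X₀ X (l := v) (by omega)]
    -- Constant and linear terms along the segment cancel; the quadratic one has coefficient `(1 -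
    -- t) - (1 - t) ^ 2`.
    have : t • eval (pair A X) p + (1 - t) • eval (pair A Y) p
        - eval (pair A (t • X + (1 - t) • Y)) p = (t * (1 - t)) • F₂ := by
      rw [h1, h2]; module
    rw [this, star_trivial, Matrix.smul_mulVec, dotProduct_smul, smul_eq_mul]
    have : 0 < 1 - t := by linarith
    positivity

end Convexity

/-! ### Gram matrices and sums of squares -/

section Gram

lemma exists_transpose_mul_self_of_posSemidef {n : ℕ} {G : Matrix (Fin n) (Fin n) ℝ}
    (hG : G.PosSemidef) : ∃ R : Matrix (Fin n) (Fin n) ℝ, G = R.transpose * R := by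
  open scoped MatrixOrder in
  obtain ⟨R, hR⟩ := CStarAlgebra.nonneg_iff_eq_star_mul_self.mp hG.nonneg
  exact ⟨R, by rw [hR, Matrix.star_eq_conjTranspose,
    Matrix.conjTranspose_eq_transpose_of_trivial]⟩

lemma transpose_mul_self_posSemidef {n : ℕ} (R : Matrix (Fin n) (Fin n) ℝ) :
    (R.transpose * R).PosSemidef := by
  simpa using Matrix.posSemidef_conjTranspose_mul_self R

lemma transpose_mul_self_apply_self {n : ℕ} (R : Matrix (Fin n) (Fin n) ℝ) (s : Fin n) :
    (R.transpose * R) s s = ∑ r, R r s ^ 2 := by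
  simp [Matrix.mul_apply, sq]

variable {σ : Type} {n : ℕ}

/-- The polynomial `∑ G_{rs} b_r* b_s` with Gram matrix `G`. -/
def gram (b : Fin n → List σ) : Matrix (Fin n) (Fin n) ℝ →ₗ[ℝ] NCPoly σ where
  toFun G := ∑ r, ∑ s, G r s • mono ((b r).reverse ++ b s)
  map_add' G G' := by simp [add_smul, Finset.sum_add_distrib]
  map_smul' c G := by simp [Finset.smul_sum, mul_smul]

lemma gram_apply (b : Fin n → List σ) (G : Matrix (Fin n) (Fin n) ℝ) :
    gram b G = ∑ r, ∑ s, G r s • mono ((b r).reverse ++ b s) := rfl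

lemma gram_transpose_mul_self (b : Fin n → List σ) (R : Matrix (Fin n) (Fin n) ℝ) :
    gram b (R.transpose * R)
      = ∑ j, star (∑ s, R j s • mono (b s)) * ∑ s, R j s • mono (b s) := by
  simp only [gram_apply, star_sum, star_smul_real, star_mono, Finset.sum_mul_sum,
    Matrix.mul_apply, Matrix.transpose_apply, Finset.sum_smul, smul_mul_smul_comm, mono_append]
  rw [Finset.sum_comm]
  conv_lhs => enter [2, s]; rw [Finset.sum_comm]
  rw [Finset.sum_comm]
  refine Finset.sum_congr rfl fun j _ => ?_
  rw [Finset.sum_comm]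

lemma gram_single (b : Fin n → List σ) (r s : Fin n) :
    gram b (Matrix.single r s 1) = mono ((b r).reverse ++ b s) := by
  rw [gram_apply, Finset.sum_eq_single r, Finset.sum_eq_single s]
  · simp
  · intro s' _ hs; simp [Matrix.single, hs.symm]
  · simp
  · intro r' _ hr; simp [Matrix.single, hr.symm]
  · simp

/-- The square of a longest surviving word cannot be cancelled: any other product of surviving words
equal to it would have factors of the same lengths, hence the same factors. So the cone of squares
is pointed and has a compact base. -/
lemma eq_zero_of_gram_eq_zero {b : Fin n → List σ} (hb : Function.Injective b)
    {G : Matrix (Fin n) (Fin n) ℝ} (hG : G.PosSemidef) (h : gram b G = 0) : G = 0 := by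
  classical
  obtain ⟨R, rfl⟩ := exists_transpose_mul_self_of_posSemidef hG
  set G := R.transpose * R with hGdef
  have hcol (s : Fin n) (hs : G s s = 0) (r : Fin n) : R r s = 0 := by
    rw [hGdef, transpose_mul_self_apply_self,
      Finset.sum_eq_zero_iff_of_nonneg fun r _ => sq_nonneg _] at hs
    simpa using hs r (Finset.mem_univ r)
  have hrow (s r : Fin n) (hs : G s s = 0) : G s r = 0 ∧ G r s = 0 := by
    simp [hGdef, Matrix.mul_apply, hcol s hs]
  have hdiag : ∀ s, G s s = 0 := by
    by_contra! hne
    obtain ⟨s₀, hs₀⟩ := hne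
    obtain ⟨s, hs, hmax⟩ := Finset.exists_max_image (Finset.univ.filter fun s => G s s ≠ 0)
      (fun s => (b s).length) ⟨s₀, by simpa using hs₀⟩
    simp only [Finset.mem_filter, Finset.mem_univ, true_and] at hs hmax
    have hc := DFunLike.congr_fun (congrArg coeffs h) ((b s).reverse ++ b s)
    simp only [gram_apply, map_sum, map_smul, coeffs_mono, map_zero, Finsupp.coe_zero,
      Pi.zero_apply, Finsupp.finsetSum_apply, Finsupp.smul_apply, Finsupp.single_apply,
      smul_eq_mul] at hc
    rw [Finset.sum_eq_single s, Finset.sum_eq_single s] at hc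
    · simp at hc; exact hs hc
    · intro t _ hts
      rw [if_neg, mul_zero]
      intro he
      exact hts (hb (List.append_cancel_left he))
    · simp
    · intro r _ hrs
      refine Finset.sum_eq_zero fun t _ => ?_
      by_cases hr0 : G r r = 0
      · rw [(hrow r t hr0).1, zero_mul]
      by_cases ht0 : G t t = 0
      · rw [(hrow t r ht0).2, zero_mul]
      rw [if_neg, mul_zero]
      intro he
      have hl := congrArg List.length he
      have h1 := hmax r hr0
      have h2 := hmax t ht0
      simp only [List.length_append, List.length_reverse] at hl
      have := List.append_inj_left he (by simp; omega)
      exact hrs (hb (List.reverse_injective this))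
    · simp
  ext s r
  exact (hrow s r (hdiag s)).1

end Gram

/-! ### Separating a polynomial from the cone of squares -/

section Separation

variable {n : ℕ}

instance : LocallyConvexSpace ℝ (Matrix (Fin n) (Fin n) ℝ) :=
  inferInstanceAs (LocallyConvexSpace ℝ (Fin n → Fin n → ℝ))

/-- Positive semidefinite matrices of trace one. -/
def density (n : ℕ) : Set (Matrix (Fin n) (Fin n) ℝ) := {G | G.PosSemidef ∧ G.trace = 1}

lemma convex_density : Convex ℝ (density n) := by
  rintro G ⟨hG, hG'⟩ H ⟨hH, hH'⟩ a c ha hc hac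
  exact ⟨(hG.smul ha).add (hH.smul hc), by simp [Matrix.trace_add, hG', hH', hac]⟩

/-- The set is the image of the Frobenius unit sphere under `R ↦ Rᵀ R`. -/
lemma isCompact_density : IsCompact (density n) := by
  let S : Set (Matrix (Fin n) (Fin n) ℝ) := {R | ∑ s, ∑ r, R r s ^ 2 = 1}
  have hS : IsCompact S := by
    have hbox : IsCompact (Set.univ.pi fun _ => Set.univ.pi fun _ => Set.Icc (-1) 1 :
        Set (Fin n → Fin n → ℝ)) :=
      isCompact_univ_pi fun _ => isCompact_univ_pi fun _ => isCompact_Icc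
    refine IsCompact.of_isClosed_subset (X := Fin n → Fin n → ℝ) hbox ?_ ?_
    · have hc : Continuous fun R : Fin n → Fin n → ℝ => ∑ s, ∑ r, R r s ^ 2 := by fun_prop
      exact isClosed_eq hc continuous_const
    · intro R hR r _ s _
      have h1 : R r s ^ 2 ≤ ∑ r, R r s ^ 2 :=
        Finset.single_le_sum (f := fun r => R r s ^ 2) (fun _ _ => sq_nonneg _)
          (Finset.mem_univ r)
      have h2 : ∑ r, R r s ^ 2 ≤ ∑ s, ∑ r, R r s ^ 2 :=
        Finset.single_le_sum (f := fun s => ∑ r, R r s ^ 2)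
          (fun _ _ => Finset.sum_nonneg fun _ _ => sq_nonneg _) (Finset.mem_univ s)
      have h3 : ∑ s, ∑ r, R r s ^ 2 = 1 := hR
      exact abs_le.1 ((sq_le_one_iff_abs_le_one _).1 (by linarith))
  have himage : density n = (fun R => R.transpose * R) '' S := by
    ext G
    constructor
    · rintro ⟨hG, hG'⟩
      obtain ⟨R, rfl⟩ := exists_transpose_mul_self_of_posSemidef hG
      refine ⟨R, ?_, rfl⟩
      change ∑ s, ∑ r, R r s ^ 2 = 1
      simpa [Matrix.trace, transpose_mul_self_apply_self] using hG'
    · rintro ⟨R, hR, rfl⟩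
      refine ⟨transpose_mul_self_posSemidef R, ?_⟩
      change ∑ s, ∑ r, R r s ^ 2 = 1 at hR
      simpa [Matrix.trace, transpose_mul_self_apply_self] using hR
  rw [himage]
  exact hS.image (by fun_prop)

lemma trace_pos_of_posSemidef {G : Matrix (Fin n) (Fin n) ℝ} (hG : G.PosSemidef) (h : G ≠ 0) :
    0 < G.trace := by
  refine lt_of_le_of_ne hG.trace_nonneg fun h0 => h ?_
  exact hG.trace_eq_zero_iff.1 h0.symm

lemma inv_trace_smul_mem_density {G : Matrix (Fin n) (Fin n) ℝ} (hG : G.PosSemidef)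
    (h : G ≠ 0) : G.trace⁻¹ • G ∈ density n := by
  have := trace_pos_of_posSemidef hG h
  exact ⟨hG.smul (inv_pos.2 this).le, by simp [this.ne']⟩

/-- Separation of a polynomial from the cone of sums of squares. -/
lemma exists_separating_functional {σ : Type} {b : Fin n → List σ} (hb : Function.Injective b)
    {P : NCPoly σ} (hP : star P = P) {G₀ : Matrix (Fin n) (Fin n) ℝ} (hG₀ : gram b G₀ = P)
    (hnot : ¬ ∃ G : Matrix (Fin n) (Fin n) ℝ, G.PosSemidef ∧ gram b G = P) :
    ∃ φ : NCPoly σ →ₗ[ℝ] ℝ, φ P < 0 ∧ (∀ f, φ (star f) = φ f) ∧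
      ∀ x : Fin n → ℝ, x ≠ 0 → 0 < φ (gram b (Matrix.vecMulVec x x)) := by
  have hPne : P ≠ 0 := fun h => hnot ⟨0, Matrix.PosSemidef.zero, by simp [h]⟩
  have hGne : G₀ ≠ 0 := by rintro rfl; exact hPne (by simp [← hG₀])
  obtain ⟨r₀⟩ : Nonempty (Fin n) := by
    by_contra hn
    rw [not_nonempty_iff] at hn
    exact hGne (Subsingleton.elim _ _)
  -- Joining `-G₀` to the base of the cone makes one separation give both signs. `K` meets the
  -- kernel of `gram b` only if `P` is a sum of squares.
  let K : Set (Matrix (Fin n) (Fin n) ℝ) := convexJoin ℝ (density n) {-G₀}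
  have hKconv : Convex ℝ K := convex_density.convexJoin (convex_singleton _)
  have hKeq : K = (fun q : Matrix (Fin n) (Fin n) ℝ × ℝ => (1 - q.2) • q.1 + q.2 • -G₀) ''
      (density n ×ˢ Set.Icc 0 1) := by
    ext G
    simp only [K, mem_convexJoin, Set.mem_singleton_iff, exists_eq_left, Set.mem_image,
      Set.mem_prod, segment_eq_image, Prod.exists]
    constructor
    · rintro ⟨D, hD, t, ht, rfl⟩; exact ⟨D, t, ⟨hD, ht⟩, rfl⟩
    · rintro ⟨D, t, ⟨hD, ht⟩, rfl⟩; exact ⟨D, hD, t, ht, rfl⟩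
  have hKcomp : IsCompact K := by
    rw [hKeq]
    exact (isCompact_density.prod isCompact_Icc).image (by fun_prop)
  have hdisj : Disjoint K (LinearMap.ker (gram b) : Set (Matrix (Fin n) (Fin n) ℝ)) := by
    rw [Set.disjoint_left, hKeq]
    rintro _ ⟨⟨D, t⟩, ⟨hD, ht⟩, rfl⟩ hker
    change D ∈ density n at hD
    change t ∈ Set.Icc 0 1 at ht
    simp only [SetLike.mem_coe, LinearMap.mem_ker, map_add, map_smul, map_neg, hG₀] at hker
    have h1 : (1 - t) • gram b D = t • P := by
      rw [smul_neg, ← sub_eq_add_neg, sub_eq_zero] at hker; exact hker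
    rcases eq_or_lt_of_le ht.1 with h0 | h0
    · rw [← h0, sub_zero, one_smul, zero_smul] at h1
      have := hD.2
      rw [eq_zero_of_gram_eq_zero hb hD.1 h1] at this
      simp at this
    · refine hnot ⟨(t⁻¹ * (1 - t)) • D, hD.1.smul (mul_nonneg (inv_nonneg.2 ht.1)
        (sub_nonneg.2 ht.2)), ?_⟩
      rw [map_smul, mul_smul, h1, smul_smul, inv_mul_cancel₀ h0.ne', one_smul]
  obtain ⟨f, c, d, hfK, hcd, hfN⟩ := geometric_hahn_banach_compact_closed hKconv hKcomp
    (LinearMap.ker (gram b)).convex (Submodule.closed_of_finiteDimensional _) hdisj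
  have hd : d < 0 := by simpa using hfN 0 (zero_mem _)
  -- A functional bounded below on a subspace vanishes there, so `-f` factors through `gram b`.
  have hfker : ∀ G ∈ LinearMap.ker (gram b), f G = 0 := by
    intro G hG
    by_contra hne
    have := hfN ((d / f G) • G) (Submodule.smul_mem _ _ hG)
    rw [map_smul, smul_eq_mul, div_mul_cancel₀ _ hne] at this
    exact lt_irrefl _ this
  have hfneg : ∀ G ∈ K, f G < 0 := fun G hG => (hfK G hG).trans (hcd.trans hd)
  have hmem : -f.toLinearMap ∈ (LinearMap.ker (gram b)).dualAnnihilator := by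
    rw [Submodule.mem_dualAnnihilator]
    intro G hG
    simpa using hfker G hG
  rw [← LinearMap.range_dualMap_eq_dualAnnihilator_ker] at hmem
  obtain ⟨ψ, hψ⟩ := hmem
  have hψ' (G : Matrix (Fin n) (Fin n) ℝ) : ψ (gram b G) = - f G := LinearMap.congr_fun hψ G
  -- Adding `ψ ∘ₗ st` gives invariance under `star` and only doubles the values on symmetric
  -- elements.
  let st : NCPoly σ →ₗ[ℝ] NCPoly σ :=
    { toFun := star, map_add' := star_add, map_smul' := star_smul_real }
  have hφ (q : NCPoly σ) (hq : star q = q) : (ψ + ψ ∘ₗ st) q = 2 * ψ q := by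
    change ψ q + ψ (star q) = _
    rw [hq, two_mul]
  refine ⟨ψ + ψ ∘ₗ st, ?_, fun q => ?_, fun x hx => ?_⟩
  · rw [hφ P hP, ← hG₀, hψ']
    obtain ⟨D, hD⟩ : (density n).Nonempty :=
      ⟨_, inv_trace_smul_mem_density (Matrix.PosSemidef.one (n := Fin n))
        (fun h => by simpa using congrFun (congrFun h r₀) r₀)⟩
    have := hfneg (-G₀) (mem_convexJoin.2 ⟨D, hD, -G₀, rfl, right_mem_segment _ _ _⟩)
    rw [map_neg] at this
    linarith
  · change ψ (star q) + ψ (star (star q)) = ψ q + ψ (star q)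
    rw [star_star, add_comm]
  · have hxx : (Matrix.vecMulVec x x).PosSemidef := by
      simpa using Matrix.posSemidef_vecMulVec_self_star x
    have hne : Matrix.vecMulVec x x ≠ 0 := by
      intro h
      apply hx
      ext i
      simpa [Matrix.vecMulVec_apply] using congrFun (congrFun h i) i
    have hsymm : star (gram b (Matrix.vecMulVec x x)) = gram b (Matrix.vecMulVec x x) := by
      simp only [gram_apply, star_sum, star_smul_real, star_mono, List.reverse_append,
        List.reverse_reverse, Matrix.vecMulVec_apply]
      rw [Finset.sum_comm]
      simp only [mul_comm]
    have htr := trace_pos_of_posSemidef hxx hne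
    have := hfneg _ (mem_convexJoin.2 ⟨_, inv_trace_smul_mem_density hxx hne, -G₀, rfl,
      left_mem_segment _ _ _⟩)
    rw [map_smul, smul_eq_mul] at this
    have := neg_of_mul_neg_right this (inv_pos.2 htr).le
    rw [hφ _ hsymm, hψ']
    linarith

end Separation

variable {g : ℕ}

/-! ### Truncated GNS construction and sums of squares -/

section SumOfSquares

/-- The part of `p` which is homogeneous of degree two in `x`. -/
def quadPart (p : NCPoly (AX g)) : NCPoly (AX g) :=
  coeffs.symm ((coeffs p).filter fun l => xDeg l = 2)

lemma coeffs_quadPart (p : NCPoly (AX g)) (l : List (AX g)) :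
    coeffs (quadPart p) l = if xDeg l = 2 then coeffs p l else 0 := by
  simp [quadPart, Finsupp.filter_apply]

lemma star_quadPart {p : NCPoly (AX g)} (hp : star p = p) : star (quadPart p) = quadPart p := by
  apply coeffs.injective
  ext l
  rw [coeffs_star, coeffs_quadPart, coeffs_quadPart, xDeg_reverse, ← coeffs_star, hp]

lemma degX_sub_quadPart {p : NCPoly (AX g)} (hd : degX p ≤ 2) : degX (p - quadPart p) ≤ 1 := by
  refine degX_le_iff.2 fun l hl => ?_
  rw [map_sub, Finsupp.sub_apply, coeffs_quadPart] at hl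
  by_cases h : xDeg l = 2
  · simp [h] at hl
  · rw [if_neg h, sub_zero] at hl
    have := degX_le_iff.1 hd l hl
    omega

lemma wordSum_quadPart {M : Type*} [AddCommGroup M] [Module ℝ M] (F : List (AX g) → M)
    (p : NCPoly (AX g)) :
    wordSum F (quadPart p) = wordSum (fun l => if xDeg l = 2 then F l else 0) p := by
  rw [wordSum_apply, wordSum_apply]
  have : (coeffs (quadPart p)).support = (coeffs p).support.filter fun l => xDeg l = 2 := by
    simp [quadPart, Finsupp.support_filter]
  rw [this, Finset.sum_filter]
  refine Finset.sum_congr rfl fun l _ => ?_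
  rw [coeffs_quadPart]
  split_ifs <;> simp

/-- Words with exactly one `x`-letter and at most `d` many `a`-letters. -/
def linearWords (g d : ℕ) : Set (List (AX g)) := {l | aDeg l ≤ d ∧ xDeg l = 1}

lemma exists_linearWords_enum (g d : ℕ) : ∃ (n : ℕ) (b : Fin n → List (AX g)),
    Function.Injective b ∧ ∀ l, l ∈ linearWords g d ↔ ∃ r, b r = l := by
  have hfin : (linearWords g d).Finite :=
    (boundedLists_finite d 1).subset fun l hl => ⟨hl.1, hl.2.le⟩
  have := hfin.fintype
  let e := (Fintype.equivFin (linearWords g d)).symm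
  refine ⟨_, fun r => (e r).1, Subtype.val_injective.comp e.injective, fun l => ⟨fun hl => ?_, ?_⟩⟩
  · exact ⟨e.symm ⟨l, hl⟩, by simp⟩
  · rintro ⟨r, rfl⟩; exact (e r).2

/-- Cut each word just after its first `x`-letter: both halves are linear words, the left one after
reversal. No positivity is claimed yet. -/
lemma quadPart_mem_range_gram {n : ℕ} {b : Fin n → List (AX g)} (p : NCPoly (AX g))
    (hb : ∀ l ∈ linearWords g (degA p), ∃ r, b r = l) :
    quadPart p ∈ LinearMap.range (gram b) := by
  rw [← wordSum_mono_eq (quadPart p), wordSum_apply]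
  refine sum_mem fun l hl => Submodule.smul_mem _ _ ?_
  have hl' : coeffs (quadPart p) l ≠ 0 := by simpa using hl
  rw [coeffs_quadPart] at hl'
  have hx : xDeg l = 2 := by by_contra h; simp [h] at hl'
  rw [if_pos hx] at hl'
  have ha := degA_le_iff.1 le_rfl l hl'
  obtain ⟨u, i, w, rfl, hu⟩ := exists_split_of_xDeg_pos (l := l) (by omega)
  simp only [aDeg_append, aDeg_cons_inr, xDeg_append, xDeg_cons_inr] at ha hx
  obtain ⟨r, hr⟩ := hb (Sum.inr i :: u.reverse) ⟨by simp; omega, by simp [hu]⟩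
  obtain ⟨s, hs⟩ := hb w ⟨by omega, by omega⟩
  exact ⟨Matrix.single r s 1, by rw [gram_single, hr, hs]; simp⟩

/-- The truncated Gelfand–Naimark–Segal construction: a functional which is strictly positive on
squares of combinations of linear words is represented by symmetric matrices. -/
lemma exists_representation {d n : ℕ} {b : Fin n → List (AX g)} (hinj : Function.Injective b)
    (hb : ∀ l, l ∈ linearWords g d ↔ ∃ r, b r = l) {φ : NCPoly (AX g) →ₗ[ℝ] ℝ}
    (hstar : ∀ f, φ (star f) = φ f)
    (hpos : ∀ x : Fin n → ℝ, x ≠ 0 → 0 < φ (gram b (Matrix.vecMulVec x x))) :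
    ∃ (A : SymTuple (Fin g) n) (e : List (AX g) → Fin n → ℝ),
      (∀ l ∈ linearWords g d, ∀ l' ∈ linearWords g d,
        e l ⬝ᵥ e l' = φ (mono (l.reverse ++ l'))) ∧
      ∀ (X : SymTuple (Fin g) n) (v l : List (AX g)), xDeg v = 0 → v ++ l ∈ linearWords g d →
        (eval (pair A X) (mono v)).mulVec (e l) = e (v ++ l) := by
  let S : Matrix (Fin n) (Fin n) ℝ := Matrix.of fun r s => φ (mono ((b r).reverse ++ b s))
  have hS (r s : Fin n) : S r s = φ (mono ((b r).reverse ++ b s)) := rfl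
  have hsym (l m : List (AX g)) : φ (mono (l.reverse ++ m)) = φ (mono (m.reverse ++ l)) := by
    rw [← hstar, star_mono]; simp
  have hSq (x : Fin n → ℝ) : x ⬝ᵥ S.mulVec x = φ (gram b (Matrix.vecMulVec x x)) := by
    simp only [gram_apply, map_sum, map_smul, dotProduct, Matrix.mulVec, Finset.mul_sum, hS,
      Matrix.vecMulVec_apply, smul_eq_mul]
    exact Finset.sum_congr rfl fun r _ => Finset.sum_congr rfl fun s _ => by ring
  have hSpd : S.PosDef := by
    refine Matrix.PosDef.of_dotProduct_mulVec_pos ?_ fun x hx => ?_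
    · ext r s
      rw [Matrix.conjTranspose_apply, star_trivial, hS, hS, hsym]
    · rw [star_trivial, hSq]; exact hpos x hx
  obtain ⟨R, hR⟩ := exists_transpose_mul_self_of_posSemidef hSpd.posSemidef
  -- Strict positivity of `φ` on squares is what makes `R` invertible; no quotient by null vectors
  -- is needed.
  have hRu : IsUnit R := by
    have := hSpd.isUnit
    rw [hR] at this
    rw [Matrix.isUnit_iff_isUnit_det] at this ⊢
    rw [Matrix.det_mul] at this
    exact isUnit_of_mul_isUnit_right this
  have hRdet : IsUnit R.det := (Matrix.isUnit_iff_isUnit_det R).1 hRu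
  let T (k : Fin g) : Matrix (Fin n) (Fin n) ℝ :=
    Matrix.of fun r s => φ (mono ((b r).reverse ++ Sum.inl k :: b s))
  have hT' (k : Fin g) (r s : Fin n) : T k r s = φ (mono ((b r).reverse ++ Sum.inl k :: b s)) := rfl
  have hT (k : Fin g) : (T k).transpose = T k := by
    ext r s
    rw [Matrix.transpose_apply, hT', hT', hsym]
    simp
  -- In the coordinates `e (b r) = R (Pi.single r 1)`, this is the compression of left
  -- multiplication by `a_k` to the span of the linear words.
  let A : SymTuple (Fin g) n := fun k => ⟨(R⁻¹).transpose * T k * R⁻¹, by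
    change ((R⁻¹).transpose * T k * R⁻¹).transpose = _
    simp [Matrix.transpose_mul, hT, Matrix.mul_assoc]⟩
  let e : List (AX g) → Fin n → ℝ :=
    Function.extend b (fun r => R.mulVec (Pi.single r 1)) 0
  have he (r : Fin n) : e (b r) = R.mulVec (Pi.single r 1) := hinj.extend_apply _ _ _
  refine ⟨A, e, fun l hl l' hl' => ?_, fun X v l hv hl => ?_⟩
  · obtain ⟨r, rfl⟩ := (hb l).1 hl
    obtain ⟨s, rfl⟩ := (hb l').1 hl'
    rw [he, he, Matrix.dotProduct_mulVec, ← Matrix.mulVec_transpose, Matrix.mulVec_mulVec, ← hR]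
    rw [dotProduct_single, mul_one, Matrix.mulVec_single_one, Matrix.col_apply, hS, hsym]
  · induction v with
    | nil => simp
    | cons c v ih =>
      rcases c with k | k
      · have hvl : v ++ l ∈ linearWords g d := by
          refine ⟨?_, ?_⟩
          · have := hl.1; simp at this ⊢; omega
          · simpa using hl.2
        rw [mono_cons, eval_mul, ← Matrix.mulVec_mulVec, ih (by simpa using hv) hvl]
        obtain ⟨s, hs⟩ := (hb _).1 hvl
        obtain ⟨s', hs'⟩ := (hb _).1 hl
        rw [← hs', ← hs, he, he, eval_ι]
        change ((R⁻¹).transpose * T k * R⁻¹).mulVec _ = _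
        rw [Matrix.mulVec_mulVec, Matrix.mul_assoc, Matrix.nonsing_inv_mul _ hRdet, Matrix.mul_one,
          ← Matrix.mulVec_mulVec]
        -- The word `a_k b_s` is again one of the listed words, namely `b s'`, so the compression is
        -- exact on it.
        have hTS : (T k).mulVec (Pi.single s 1) = S.mulVec (Pi.single s' 1) := by
          ext r
          rw [Matrix.mulVec_single_one, Matrix.mulVec_single_one, Matrix.col_apply,
            Matrix.col_apply, hT', hS, hs, hs', List.cons_append]
        rw [hTS, hR, Matrix.mulVec_mulVec, ← Matrix.mul_assoc, ← Matrix.transpose_mul,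
          Matrix.mul_nonsing_inv _ hRdet, Matrix.transpose_one, Matrix.one_mul]
      · simp at hv

lemma exists_posSemidef_gram_quadPart {p : NCPoly (AX g)} (hp : star p = p) (hd : degX p ≤ 2)
    (hpos : ∀ n, ∃ X : SymTuple (Fin g) n, ∀ A ξ, 0 ≤ formₗ (pair A X) ξ ξ p) {n : ℕ}
    {b : Fin n → List (AX g)} (hinj : Function.Injective b)
    (hb : ∀ l, l ∈ linearWords g (degA p) ↔ ∃ r, b r = l) :
    ∃ G : Matrix (Fin n) (Fin n) ℝ, G.PosSemidef ∧ gram b G = quadPart p := by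
  by_contra hnot
  obtain ⟨G₀, hG₀⟩ := quadPart_mem_range_gram p fun l hl => (hb l).1 hl
  obtain ⟨φ, hneg, hstar, hφ⟩ := exists_separating_functional hinj (star_quadPart hp) hG₀ hnot
  obtain ⟨A, e, he, hA⟩ := exists_representation hinj hb hstar hφ
  obtain ⟨X, hX⟩ := hpos n
  -- With these border vectors each splitting `u x_i v x_j w` contributes `φ` of the whole word, so
  -- the form equals `φ (quadPart p)`, which is negative.
  refine absurd (hX A fun j w => e (Sum.inr j :: w)) (not_le.2 ?_)
  refine lt_of_eq_of_lt ?_ hneg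
  rw [linearMap_eq_wordSum φ, wordSum_quadPart, formₗ]
  refine wordSum_congr fun l hl => ?_
  have hx := degX_le_iff.1 hd l hl
  have ha := degA_le_iff.1 le_rfl l hl
  split_ifs with h2
  · rw [sum₂_congr (F' := fun _ _ _ _ _ => φ (mono l)), sum₂_const, h2]
    · simp
    · rintro u i v j w rfl
      simp only [aDeg_append, aDeg_cons_inr, xDeg_append, xDeg_cons_inr] at ha h2
      have hmem : v ++ Sum.inr j :: w ∈ linearWords g (degA p) :=
        ⟨by simp; omega, by simp; omega⟩
      rw [hA X v _ (by omega) hmem, he _ ⟨by simp; omega, by simp; omega⟩ _ hmem]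
      simp
  · exact sum₂_eq_zero (by omega) _

lemma exists_sum_of_squares {p : NCPoly (AX g)} (hp : star p = p) (hd : degX p ≤ 2)
    (hpos : ∀ n, ∃ X : SymTuple (Fin g) n, ∀ A ξ, 0 ≤ formₗ (pair A X) ξ ξ p) :
    ∃ (L : NCPoly (AX g)) (k : ℕ) (Λ : Fin k → NCPoly (AX g)),
      degX L ≤ 1 ∧ (∀ j, LinearInX (Λ j)) ∧ p = L + ∑ j, star (Λ j) * Λ j := by
  classical
  obtain ⟨n, b, hinj, hb⟩ := exists_linearWords_enum g (degA p)
  obtain ⟨G, hG, hGp⟩ := exists_posSemidef_gram_quadPart hp hd hpos hinj hb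
  obtain ⟨R, rfl⟩ := exists_transpose_mul_self_of_posSemidef hG
  refine ⟨p - quadPart p, n, fun j => ∑ s, R j s • mono (b s), degX_sub_quadPart hd,
    fun j w hw => ?_, ?_⟩
  · rw [mem_words_iff] at hw
    simp only [map_sum, map_smul, coeffs_mono, Finsupp.finsetSum_apply, Finsupp.smul_apply,
      Finsupp.single_apply] at hw
    obtain ⟨s, -, hs⟩ := Finset.exists_ne_zero_of_sum_ne_zero hw
    have hbs : b s = w.toList := by by_contra h; simp [h] at hs
    have := ((hb (b s)).2 ⟨s, rfl⟩).2
    rw [hbs] at this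
    exact this
  · rw [← gram_transpose_mul_self, hGp, sub_add_cancel]

end SumOfSquares

/-! ### Nonemptiness at every matrix size -/

section MatrixConvexDomains

lemma level_nonempty {ι : Type} {V : NCDomain ι} (hV : V.MatrixConvex) {n : ℕ} (hn : 0 < n)
    (hne : (V.level n).Nonempty) (m : ℕ) : (V.level m).Nonempty := by
  obtain ⟨Y, hY⟩ := hne
  have hlarge : ∀ k, ∃ N, k ≤ N ∧ (V.level N).Nonempty := by
    intro k
    induction k with
    | zero => exact ⟨n, Nat.zero_le _, Y, hY⟩
    | succ k ih =>
      obtain ⟨N, hN, Z, hZ⟩ := ih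
      exact ⟨N + n, by omega, _, V.dsum_mem hZ hY⟩
  obtain ⟨N, hN, Z, hZ⟩ := hlarge m
  -- Direct sums reach a size `N ≥ m`; the isometry includes the first `m` coordinates.
  refine ⟨_, hV N m ((1 : Matrix (Fin N) (Fin N) ℝ).submatrix id (Fin.castLE hN)) ?_ Z hZ⟩
  rw [Matrix.transpose_submatrix, Matrix.transpose_one,
    ← Matrix.submatrix_mul _ _ _ _ _ Function.bijective_id, Matrix.one_mul,
    Matrix.submatrix_one _ (Fin.castLE_injective hN)]

end MatrixConvexDomains

/-! ### Conclusion -/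

/-- If no nonzero polynomial of small degree vanishes on the domain, the middle form is positive. -/
lemma formₗ_nonneg_of_not_vanishing {p : NCPoly (AX g)} {W : NCDomain (AX g)}
    (hW : HessianPosSemidefOn p W)
    (hne : ∀ q ∈ boundedPolys g (degA p) (degX p - 2),
      (∀ (n : ℕ), ∀ Y ∈ W.level n, eval Y q = 0) → q = 0) :
    ∀ (n : ℕ), ∀ Y ∈ W.level n, ∀ ξ, 0 ≤ formₗ Y ξ ξ p := by
  intro n Y hY ξ
  obtain ⟨m, Z, v₀, hZ, hsep⟩ := exists_separating W _ hne ⟨n, Y, hY⟩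
  exact formₗ_nonneg hW hZ hsep hY ξ

end NCConvex

end

theorem mainTheorem3 (g : ℕ) (p : NCConvex.NCPoly (NCConvex.AX g)) (hp : star p = p)
    (hdx : 2 ≤ NCConvex.degX p) :
    (∀ W : NCConvex.NCDomain (NCConvex.AX g),
      W.OpenInA → NCConvex.HessianPosSemidefOn p W →
        (∃ q : NCConvex.NCPoly (NCConvex.AX g), q ≠ 0 ∧
          NCConvex.degA q ≤ NCConvex.degA p ∧ NCConvex.degX q ≤ NCConvex.degX p - 2 ∧
          NCConvex.VanishesOn q W) ∨
        (NCConvex.degX p ≤ 2 ∧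
          ∀ (n : ℕ), ∀ A ∈ W.projA n, NCConvex.GloballyConvexAt p A)) ∧
    (∀ V : NCConvex.NCDomain (Fin g), V.MatrixConvex →
      NCConvex.HessianPosSemidefOn p ((NCConvex.NCDomain.whole (Fin g)).prod V) →
        (∃ q : NCConvex.NCPoly (NCConvex.AX g), q ≠ 0 ∧
          NCConvex.degA q ≤ NCConvex.degA p ∧ NCConvex.degX q ≤ NCConvex.degX p - 2 ∧
          NCConvex.VanishesOn q ((NCConvex.NCDomain.whole (Fin g)).prod V)) ∨
        (∃ (L : NCConvex.NCPoly (NCConvex.AX g)) (k : ℕ)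
          (Λ : Fin k → NCConvex.NCPoly (NCConvex.AX g)),
          NCConvex.degX L ≤ 1 ∧ (∀ j, NCConvex.LinearInX (Λ j)) ∧
          p = L + ∑ j, star (Λ j) * Λ j)) := by
  open NCConvex in
  have main (W : NCDomain (AX g)) (hne : ¬ ∃ q : NCPoly (AX g), q ≠ 0 ∧ degA q ≤ degA p ∧
      degX q ≤ degX p - 2 ∧ VanishesOn q W) :
      ∀ q ∈ boundedPolys g (degA p) (degX p - 2),
        (∀ (n : ℕ), ∀ Y ∈ W.level n, eval Y q = 0) → q = 0 := by
    intro q hq hv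
    by_contra h0
    obtain ⟨h1, h2⟩ := mem_boundedPolys_iff_deg.1 hq
    exact hne ⟨q, h0, h1, h2, hv⟩
  constructor
  · intro W _ hW
    refine or_iff_not_imp_left.2 fun hq => ?_
    have hne := main W hq
    have hpos := NCConvex.formₗ_nonneg_of_not_vanishing hW hne
    have hd := NCConvex.degX_le_two hp hpos hne
    refine ⟨hd, fun n A hA => ?_⟩
    obtain ⟨X, hX⟩ := hA
    exact NCConvex.globallyConvexAt_of_formₗ_nonneg hp hd A X (hpos n _ hX)
  · intro V hV hW
    refine or_iff_not_imp_left.2 fun hq => ?_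
    have hne := main _ hq
    have hpos := NCConvex.formₗ_nonneg_of_not_vanishing hW hne
    have hd := NCConvex.degX_le_two hp hpos hne
    refine NCConvex.exists_sum_of_squares hp hd fun m => ?_
    have hn : ∃ n, 0 < n ∧ (V.level n).Nonempty := by
      by_contra! hcon
      -- If every positive size is empty, the constant `1` vanishes on the domain: at size zero all
      -- matrices coincide.
      refine one_ne_zero (hne 1 ?_ fun n Y hY => ?_)
      · exact NCConvex.mono_mem_boundedPolys (l := []) (Nat.zero_le _) (Nat.zero_le _)
      · rcases Nat.eq_zero_or_pos n with rfl | hn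
        · exact Subsingleton.elim _ _
        · have hmem : (fun j => Y (Sum.inr j)) ∈ V.level n := hY.2
          rw [hcon n hn] at hmem
          exact hmem.elim
    obtain ⟨n, hn, hVn⟩ := hn
    obtain ⟨X, hX⟩ := NCConvex.level_nonempty hV hn hVn m
    exact ⟨X, fun A ξ => hpos m _ ⟨trivial, hX⟩ ξ⟩
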